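/- For elements $x,q$ of a commutative ring put $(x;q)_n=\prod_{j=1}^{n}(1-xq^{j-1})$. For a nonzero integer $b$ let $$\mathcal R_b=\varprojlim_k \mathbb Z[1/b][q]/\big((q;q^2)_k\big),\qquad \mathcal S_b=\varprojlim_k \mathbb Z[1/b][q]/\big((q;q)_k\big),$$ and let $\mathcal S_b\to\mathcal R_b$ be the natural ring homomorphism induced by the identity of $\mathbb Z[1/b][q]$. For a complex root of unity $\xi$ of odd order, substituting $q=\xi$ defines a ring homomorphism $\mathrm{ev}_\xi:\mathcal R_b\to\mathbb C$. If $r$ is the odd order of $\xi$ and $f(n)$ is a Laurent polynomial in $q$ for each odd $n$, put $$\sum_n{}^{\!\xi} f(n)=\sum_{0<n<2r,\ n\text{ odd}} f(n)\big|_{q=\xi}.$$ For $n\ge 1$ and $k\ge 0$ let $$A(n,k)=\frac{\prod_{i=0}^{k}(q^n+q^{-n}-q^i-q^{-i})}{(1-q)\,(q^{k+1};q)_{k+1}},\qquad [n]=\frac{q^{n/2}-q^{-n/2}}{q^{1/2}-q^{-1/2}};$$ for odd $n$ both are Laurent polynomials in $q$. Finally put $$F_{U^b}(\xi)=\sum_n{}^{\!\xi}\,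 q^{b(n^2-1)/4}\,[n]^2 .$$ Theorem (Laplace transform). Let $b=\pm1$ or $b=\pm p^l$ with $p$ prime and $l\ge 1$, and let $k\ge 0$. There is an element $Q_{b,k}\in\mathcal R_b$ with the following properties. 1. For every root of unity $\xi$ of odd order $r$ one has $F_{U^b}(\xi)\neq 0$, and, provided that $k=0$ or $r>2k+1$, $$\frac{\sum_n^{\xi}\, q^{b(n^2-1)/4}\,A(n,k)}{F_{U^b}(\xi)}=\mathrm{ev}_\xi(Q_{b,k}).$$ 2. If $b$ is odd, then $Q_{b,k}$ lies in (the image of) $\mathcal S_b$. -/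

import Mathlib

noncomputable section

open Polynomial

/-- The `q`-Pochhammer symbol `(x; q)_n = ∏_{j=1}^n (1 - x q^(j-1))`. -/
def qPoch {R : Type*} [CommRing R] (x q : R) (n : ℕ) : R :=
  ∏ j ∈ Finset.range n, (1 - x * q ^ j)

/-- The ring `ℤ[1/b]`, as a subring of `ℚ`. -/
abbrev ZInv (b : ℤ) : Subalgebra ℤ ℚ := Algebra.adjoin ℤ {(b : ℚ)⁻¹}

theorem qPoch_dvd_of_le {R : Type*} [CommRing R] (x q : R) {m n : ℕ} (h : m ≤ n) :
    qPoch x q m ∣ qPoch x q n :=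
  Finset.prod_dvd_prod_of_subset _ _ _ (Finset.range_subset_range.2 h)

theorem span_qPoch_le {R : Type*} [CommRing R] (x q : R) {m n : ℕ} (h : m ≤ n) :
    Ideal.span {qPoch x q n} ≤ Ideal.span {qPoch x q m} :=
  Ideal.span_singleton_le_span_singleton.2 (qPoch_dvd_of_le x q h)

/-- The inverse limit over `k` of the rings `R / ((x; q)_k)`, as the ring of compatible families. -/
def pochCompletion {R : Type*} [CommRing R] (x q : R) :
    Subring (∀ k : ℕ, R ⧸ Ideal.span {qPoch x q k}) where
  carrier := {f | ∀ (m n : ℕ) (h : m ≤ n), Ideal.Quotient.factor (span_qPoch_le x q h) (f n) = f m}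
  mul_mem' hf hg m n h := by simp [hf m n h, hg m n h]
  one_mem' m n h := by simp
  add_mem' hf hg m n h := by simp [hf m n h, hg m n h]
  zero_mem' m n h := by simp
  neg_mem' hf m n h := by simp [hf m n h]

/-- The projection of the inverse limit onto its `k`-th term. -/
def pochProj {R : Type*} [CommRing R] (x q : R) (k : ℕ) :
    pochCompletion x q →+* R ⧸ Ideal.span {qPoch x q k} where
  toFun f := f.1 k
  map_one' := rfl
  map_mul' _ _ := rfl
  map_zero' := rfl
  map_add' _ _ := rfl

/-- The ring `R_b = lim_k ℤ[1/b][q] / ((q; q²)_k)`. -/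
abbrev CycR (b : ℤ) : Type := pochCompletion (X : (ZInv b)[X]) (X ^ 2)

/-- The ring `S_b = lim_k ℤ[1/b][q] / ((q; q)_k)`. -/
abbrev CycS (b : ℤ) : Type := pochCompletion (X : (ZInv b)[X]) X

theorem qPoch_sq_dvd {R : Type*} [CommRing R] (q : R) (k : ℕ) :
    qPoch q (q ^ 2) k ∣ qPoch q q (2 * k) := by
  have h : qPoch q (q ^ 2) k =
      ∏ i ∈ (Finset.range k).image (fun j => 2 * j), (1 - q * q ^ i) := by
    rw [Finset.prod_image (by intro a _ c _ hac; simpa using hac)]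
    simp [qPoch, pow_mul]
  rw [h]
  refine Finset.prod_dvd_prod_of_subset _ _ _ fun i hi => ?_
  simp only [Finset.mem_image, Finset.mem_range] at hi ⊢
  omega

theorem span_qPoch_two_mul_le {R : Type*} [CommRing R] (q : R) (k : ℕ) :
    Ideal.span {qPoch q q (2 * k)} ≤ Ideal.span {qPoch q (q ^ 2) k} :=
  Ideal.span_singleton_le_span_singleton.2 (qPoch_sq_dvd q k)

/-- The natural homomorphism `S_b → R_b`, induced by the identity of `ℤ[1/b][q]`:
its `k`-th component is the reduction of the `2k`-th component modulo `(q; q²)_k`. -/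
def cycSToR (b : ℤ) : CycS b →+* CycR b :=
  (RingHom.pi fun k =>
      (Ideal.Quotient.factor (span_qPoch_two_mul_le (X : (ZInv b)[X]) k)).comp
        (pochProj X X (2 * k))).codRestrict (pochCompletion (X : (ZInv b)[X]) (X ^ 2)) (by
    intro f m n h
    have h2 := f.2 (2 * m) (2 * n) (by omega)
    change Ideal.Quotient.factor (span_qPoch_le X (X ^ 2) h)
        (Ideal.Quotient.factor (span_qPoch_two_mul_le X n) (f.1 (2 * n))) =
      Ideal.Quotient.factor (span_qPoch_two_mul_le X m) (f.1 (2 * m))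
    rw [← h2]
    simp only [Ideal.Quotient.factor_comp_apply])

theorem qPoch_sq_eq_zero {ξ : ℂ} (hξ : Odd (orderOf ξ)) :
    qPoch ξ (ξ ^ 2) ((orderOf ξ + 1) / 2) = 0 := by
  obtain ⟨m, hm⟩ := hξ
  refine Finset.prod_eq_zero (i := m) (Finset.mem_range.2 (by omega)) ?_
  rw [← pow_mul, ← pow_succ', ← hm, pow_orderOf_eq_one, sub_self]

/-- The evaluation `ev_ξ : R_b → ℂ`, `q ↦ ξ`, at a root of unity `ξ` of odd order `r`. It factors
through the quotient by `(q; q²)_k` with `k = (r + 1) / 2`, which vanishes at `q = ξ`. -/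
def evR (b : ℤ) (ξ : ℂ) (hξ : Odd (orderOf ξ)) : CycR b →+* ℂ :=
  (Ideal.Quotient.lift (Ideal.span {qPoch (X : (ZInv b)[X]) (X ^ 2) ((orderOf ξ + 1) / 2)})
      (aeval ξ : (ZInv b)[X] →ₐ[ZInv b] ℂ).toRingHom (by
        intro a ha
        obtain ⟨c, rfl⟩ := Ideal.mem_span_singleton.1 ha
        have h : aeval ξ (qPoch (X : (ZInv b)[X]) (X ^ 2) ((orderOf ξ + 1) / 2)) = 0 := by
          rw [← qPoch_sq_eq_zero hξ]
          simp [qPoch, map_prod]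
        simp [h])).comp
    (pochProj X (X ^ 2) ((orderOf ξ + 1) / 2))

/-- The variable `q`, in the field `ℚ(q)`. -/
abbrev qv : RatFunc ℚ := RatFunc.X

/-- The Gauss-type sum `∑_n^ξ f`: the sum of `ev_ξ (f n)`, i.e. of `f n` at `q = ξ`, over the odd `n`
with `0 < n < 2 r`, where `r` is the order of `ξ`. The functions `f n` used below are Laurent
polynomials in `q` for odd `n`; `RatFunc.eval` evaluates the reduced fraction, whose denominator is
then a power of `q`. -/
def xiSum (ξ : ℂ) (f : ℕ → RatFunc ℚ) : ℂ :=
  ∑ n ∈ (Finset.range (2 * orderOf ξ)).filter Odd, (f n).eval (algebraMap ℚ ℂ) ξ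

/-- The framing factor `q^(b (n² - 1) / 4)`, for odd `n` (then `4 ∣ n² - 1`). -/
def framingFactor (b : ℤ) (n : ℕ) : RatFunc ℚ := qv ^ (b * (((n : ℤ) ^ 2 - 1) / 4))

/-- The quantum integer `[n] = (q^(n/2) - q^(-n/2)) / (q^(1/2) - q^(-1/2))` for odd `n`, written
without half-integral powers as `q^(-(n-1)/2) (q^n - 1) / (q - 1)`. -/
def quantumInt (n : ℕ) : RatFunc ℚ := qv ^ (-(((n : ℤ) - 1) / 2)) * ((qv ^ n - 1) / (qv - 1))

/-- The colored Jones polynomial of the unknot `U^b` with framing `b` and odd color `n`. -/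
def jonesUnknot (b : ℤ) (n : ℕ) : RatFunc ℚ := framingFactor b n * quantumInt n

/-- `F_{U^b}(ξ) = ∑_n^ξ J_{U^b}(n) [n]`. -/
def FUnknot (b : ℤ) (ξ : ℂ) : ℂ := xiSum ξ fun n => jonesUnknot b n * quantumInt n

/-- `A(n, k) = ∏_{i=0}^k (q^n + q^(-n) - q^i - q^(-i)) / ((1 - q) (q^(k+1); q)_{k+1})`.
It is a Laurent polynomial in `q`. -/
def cycA (n k : ℕ) : RatFunc ℚ :=
  (∏ i ∈ Finset.range (k + 1),
      (qv ^ n + qv ^ (-(n : ℤ)) - qv ^ i - qv ^ (-(i : ℤ)))) /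
    ((1 - qv) * qPoch (qv ^ (k + 1)) qv (k + 1))

end

noncomputable section

open Polynomial

/-! Put n = 2m + 1 and Γ = ∑ ξ^(b m (m + 1)). Completing the square shows that, after division by Γ,
the monomial q^(j n) contributes `gaussVal b j ξ`, an incarnation of q^(-j²/b) (`gaussSum_range`).
By the symmetry n ↔ -n, the numerator of A(n, k) may be replaced by twice q^(-k(k+1)/2) z^(-k)
`symbolPoly` at z = q^n. For k > 0 the quotient is thus, up to a power of q, the product of L/D and
(1 - q)/(q^(-1/b) - 1), where L is the Laplace transform of the symbol and D = (q^(k+1); q)_(k+1).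
Both factors are values of elements of S_b.

Write b = sB with s = ±1. Then q^(-j²/b) is a root of q^(s j²) Y^(B+1) = Y. Invertibility of B makes
the roots simple, so Newton's method lifts the values at N-th roots of unity uniquely modulo (q^N -
1)^M (`gaussLift_newton`); the lifts assemble into elements of S_b. The second factor is then a
geometric sum (`exists_mul_sub_one_eq`).

That D divides L is checked root by root over ℂ (`qPoch_dvd_laplace_complex`). Differentiating the
equation shows that B q∂/∂q on transforms corresponds to a second order heat operator on symbols,
which costs at most two orders of vanishing. If c bounds the multiplicity of ξ in D, the symbol
vanishes at every (ξ, ξ^t) to order at least 2c - 1, so the Euler derivatives of L of orders 0, ...,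
c - 1 vanish at ξ. -/

/-! ### Quadratic Gauss sums with a linear term -/

/-- The normalised Gauss sum `∑ q^(b (n² - 1) / 4 + j n) / ∑ q^(b (n² - 1) / 4)` at `q = ξ`:
it equals `ξ^(-j h)` if `b h ≡ j` modulo the order of `ξ`, and vanishes if there is no such `h`. -/
def gaussVal (b j : ℤ) (ξ : ℂ) : ℂ :=
  open Classical in
  if h : ∃ h : ℤ, ξ ^ (b * h) = ξ ^ j then ξ ^ (-(j * h.choose)) else 0

/-- Independence of the chosen solution: for two solutions h and h', both ξ^(j h) and ξ^(j h') equal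
ξ^(b h h'). -/
theorem gaussVal_of_zpow_eq {b j h : ℤ} {ξ : ℂ} (hh : ξ ^ (b * h) = ξ ^ j) :
    gaussVal b j ξ = ξ ^ (-(j * h)) := by
  have hex : ∃ h : ℤ, ξ ^ (b * h) = ξ ^ j := ⟨h, hh⟩
  have hs := hex.choose_spec
  rw [gaussVal, dif_pos hex]
  set h' := hex.choose
  rw [zpow_neg, zpow_neg, zpow_mul, zpow_mul]
  nth_rewrite 1 [← hh]
  rw [← zpow_mul, mul_right_comm, zpow_mul, hs]

theorem gaussVal_eq_zero {b j : ℤ} {ξ : ℂ} (hh : ∀ h : ℤ, ξ ^ (b * h) ≠ ξ ^ j) :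
    gaussVal b j ξ = 0 :=
  dif_neg fun ⟨h, e⟩ => hh h e

theorem gaussVal_congr {b j j' : ℤ} {ξ : ℂ} (hj : ξ ^ j = ξ ^ j') :
    gaussVal b j ξ = gaussVal b j' ξ := by
  by_cases hex : ∃ h : ℤ, ξ ^ (b * h) = ξ ^ j
  · obtain ⟨h, hh⟩ := hex
    rw [gaussVal_of_zpow_eq hh, gaussVal_of_zpow_eq (hh.trans hj), zpow_neg, zpow_neg, zpow_mul,
      zpow_mul, hj]
  · push Not at hex
    rw [gaussVal_eq_zero hex, gaussVal_eq_zero fun h => hj ▸ hex h]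

theorem gaussVal_eq_zero_or_pow {s : ℤ} (hs : s * s = 1) (B : ℕ) (j : ℤ) (ξ : ℂ) :
    gaussVal (s * B) j ξ = 0 ∨ gaussVal (s * B) j ξ ^ B = ξ ^ (-(s * j ^ 2)) := by
  by_cases hex : ∃ h : ℤ, ξ ^ (s * B * h) = ξ ^ j
  · right
    obtain ⟨h, hh⟩ := hex
    have h1 : -(j * h) * (B : ℤ) = (s * B * h) * (-(s * j)) := by linear_combination (j * h * B) * hs
    rw [gaussVal_of_zpow_eq hh, ← zpow_natCast, ← zpow_mul, h1, zpow_mul, hh, ← zpow_mul]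
    congr 1
    ring
  · left
    push Not at hex
    exact gaussVal_eq_zero hex

theorem gaussVal_one_ne_one {b : ℤ} {ξ : ℂ} (hξ : ξ ≠ 1) : gaussVal b 1 ξ ≠ 1 := by
  by_cases hex : ∃ h : ℤ, ξ ^ (b * h) = ξ ^ (1 : ℤ)
  · obtain ⟨h, hh⟩ := hex
    rw [gaussVal_of_zpow_eq hh]
    intro h1
    apply hξ
    rw [one_mul, zpow_neg, inv_eq_one] at h1
    rw [mul_comm, zpow_mul, h1, one_zpow, zpow_one] at hh
    exact hh.symm
  · push Not at hex
    rw [gaussVal_eq_zero hex]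
    exact zero_ne_one

section GaussSum

variable {r : ℕ} [NeZero r] {ψ : AddChar (ZMod r) ℂ}

theorem gaussSum_shift (ψ : AddChar (ZMod r) ℂ) {b j h : ZMod r} (hh : b * h = j) :
    ∑ m : ZMod r, ψ (b * (m * (m + 1)) + j * (2 * m + 1)) =
      ψ (-(j * h)) * ∑ m : ZMod r, ψ (b * (m * (m + 1))) := by
  rw [← Equiv.sum_comp (Equiv.addRight h) fun m => ψ (b * (m * (m + 1))), Finset.mul_sum]
  refine Finset.sum_congr rfl fun m _ => ?_
  rw [← AddChar.map_add_eq_mul]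
  congr 1
  simp only [Equiv.coe_addRight]
  subst hh
  ring

/-- Take h = r / gcd(b, r), which kills b. If it also killed j, the gcd would divide j and Bézout
would solve the congruence. -/
theorem exists_mul_eq_zero_of_forall_ne {b j : ZMod r} (hj : ∀ h, b * h ≠ j) :
    ∃ h, b * h = 0 ∧ j * h ≠ 0 := by
  obtain ⟨b, rfl⟩ := ZMod.intCast_surjective b
  obtain ⟨j, rfl⟩ := ZMod.intCast_surjective j
  have hr : (r : ℤ) ≠ 0 := by exact_mod_cast NeZero.ne r
  set c := Int.gcd b r with hc
  have hc0 : (c : ℤ) ≠ 0 := by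
    rw [hc]; exact_mod_cast (Int.gcd_pos_of_ne_zero_right b hr).ne'
  obtain ⟨r', hr'⟩ : (c : ℤ) ∣ r := Int.gcd_dvd_right b r
  obtain ⟨b', hb'⟩ : (c : ℤ) ∣ b := Int.gcd_dvd_left b r
  refine ⟨r', ?_, fun h0 => ?_⟩
  · have : b * r' = r * b' := by rw [hr', hb']; ring
    rw [← Int.cast_mul, this]
    simp
  · rw [← Int.cast_mul, ZMod.intCast_zmod_eq_zero_iff_dvd, hr'] at h0
    have hr0 : r' ≠ 0 := by rintro rfl; exact hr (by rw [hr', mul_zero])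
    obtain ⟨t, ht⟩ := Int.dvd_of_mul_dvd_mul_right hr0 h0
    have hbez := Int.gcd_eq_gcd_ab b r
    apply hj ((Int.gcdA b r * t : ℤ) : ZMod r)
    rw [ht, ← hc] at *
    rw [hbez]
    push_cast
    simp
    ring

/-- Translating m by an h with b h = 0 and j h ≠ 0 multiplies the sum by ψ(2 j h), which is not 1
because r is odd. -/
theorem gaussSum_eq_zero (hr : Odd r) (hψ : ψ.IsPrimitive) {b j : ZMod r} (hj : ∀ h, b * h ≠ j) :
    ∑ m : ZMod r, ψ (b * (m * (m + 1)) + j * (2 * m + 1)) = 0 := by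
  obtain ⟨h, h0, h1⟩ := exists_mul_eq_zero_of_forall_ne hj
  have h2 : IsUnit (2 : ZMod r) := by
    have := (ZMod.isUnit_iff_coprime 2 r).2 (Nat.coprime_two_left.2 hr)
    simpa using this
  have hne : ψ (2 * (j * h)) ≠ 1 := by
    intro e
    obtain ⟨x, hx⟩ : ∃ x : ZMod r, x = 2 * (j * h) := ⟨_, rfl⟩
    have hx0 : x ≠ 0 := by
      rw [hx]
      intro e0
      exact h1 ((h2.mul_right_eq_zero).1 e0)
    rw [← hx] at e
    exact hx0 ((AddChar.IsPrimitive.zmod_char_eq_one_iff r hψ x).1 e)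
  set S := ∑ m : ZMod r, ψ (b * (m * (m + 1)) + j * (2 * m + 1)) with hS
  have key : S = ψ (2 * (j * h)) * S := by
    conv_lhs => rw [hS]
    rw [← Equiv.sum_comp (Equiv.addRight h), hS, Finset.mul_sum]
    refine Finset.sum_congr rfl fun m _ => ?_
    rw [← AddChar.map_add_eq_mul]
    congr 1
    simp only [Equiv.coe_addRight]
    linear_combination (2 * m + 1 + h) * h0
  have : (1 - ψ (2 * (j * h))) * S = 0 := by linear_combination key
  rcases mul_eq_zero.1 this with h' | h'
  · exact absurd (by linear_combination -h') hne
  · exact h'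

/-- The product of the sums for b and -b is r times the number of h with b h = 0, by the
substitution n = m + h and orthogonality. This allows b to be a zero divisor. -/
theorem gaussSum_ne_zero (hr : Odd r) (hψ : ψ.IsPrimitive) (b : ZMod r) :
    ∑ m : ZMod r, ψ (b * (m * (m + 1))) ≠ 0 := by
  have h2 : IsUnit (2 : ZMod r) := by
    have := (ZMod.isUnit_iff_coprime 2 r).2 (Nat.coprime_two_left.2 hr)
    simpa using this
  have key : (∑ m : ZMod r, ψ (b * (m * (m + 1)))) * ∑ m : ZMod r, ψ (-b * (m * (m + 1))) =
      (r : ℂ) * (Finset.univ.filter fun h : ZMod r => b * h = 0).card := by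
    rw [mul_comm, Finset.sum_mul_sum]
    have h3 : ∀ m : ZMod r, ∑ n : ZMod r, ψ (-b * (m * (m + 1))) * ψ (b * (n * (n + 1))) =
        ∑ h : ZMod r, ψ (b * (h * (h + 1))) * ψ (m * (2 * (b * h))) := by
      intro m
      rw [← Equiv.sum_comp (Equiv.addRight m)]
      refine Finset.sum_congr rfl fun h _ => ?_
      rw [← AddChar.map_add_eq_mul, ← AddChar.map_add_eq_mul]
      congr 1
      simp only [Equiv.coe_addRight]
      ring
    simp_rw [h3]
    rw [Finset.sum_comm]
    simp_rw [← Finset.mul_sum, AddChar.sum_mulShift _ hψ, ZMod.card, h2.mul_right_eq_zero]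
    rw [Finset.card_filter, Nat.cast_sum, Finset.mul_sum]
    refine Finset.sum_congr rfl fun h _ => ?_
    split_ifs with h0
    · rw [← mul_assoc, h0]
      simp
    · simp
  intro h0
  rw [h0, zero_mul] at key
  have h4 : (0 : ZMod r) ∈ Finset.univ.filter fun h : ZMod r => b * h = 0 := by simp
  have h5 := Finset.card_pos.2 ⟨_, h4⟩
  have h6 : (r : ℂ) ≠ 0 := by exact_mod_cast NeZero.ne r
  exact (mul_ne_zero h6 (by exact_mod_cast h5.ne')) key.symm

end GaussSum

theorem zmodChar_intCast {r : ℕ} [NeZero r] {ξ : ℂ} (hξ : ξ ^ r = 1) (n : ℤ) :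
    AddChar.zmodChar r hξ n = ξ ^ n := by
  have h1 : (n : ZMod r) = n • (1 : ZMod r) := by simp
  rw [h1, AddChar.map_zsmul_eq_zpow]
  congr 1
  simpa using AddChar.zmodChar_apply' hξ 1

theorem sum_range_natCast_zmod {r : ℕ} [NeZero r] {M : Type*} [AddCommMonoid M] (f : ZMod r → M) :
    ∑ m ∈ Finset.range r, f m = ∑ m : ZMod r, f m :=
  Finset.sum_nbij' (fun m => (m : ZMod r)) ZMod.val (by simp)
    (fun m _ => Finset.mem_range.2 (ZMod.val_lt m))
    (fun m hm => ZMod.val_cast_of_lt (Finset.mem_range.1 hm)) (by simp) (by simp)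

theorem sum_range_zpow_eq_zmod {r : ℕ} [NeZero r] {ξ : ℂ} (hξ : ξ ^ r = 1) (b j : ℤ) :
    ∑ m ∈ Finset.range r, ξ ^ (b * (m * (m + 1)) + j * (2 * m + 1) : ℤ) =
      ∑ m : ZMod r, AddChar.zmodChar r hξ (b * (m * (m + 1)) + j * (2 * m + 1)) := by
  rw [← sum_range_natCast_zmod]
  refine Finset.sum_congr rfl fun m _ => ?_
  rw [← zmodChar_intCast hξ]
  congr 1
  push_cast
  ring

theorem gaussSum_range {ξ : ℂ} (hr : Odd (orderOf ξ)) (b j : ℤ) :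
    ∑ m ∈ Finset.range (orderOf ξ), ξ ^ (b * (m * (m + 1)) + j * (2 * m + 1) : ℤ) =
      gaussVal b j ξ * ∑ m ∈ Finset.range (orderOf ξ), ξ ^ (b * (m * (m + 1)) : ℤ) := by
  have : NeZero (orderOf ξ) := ⟨hr.pos.ne'⟩
  have hξ := pow_orderOf_eq_one ξ
  have hψ := AddChar.zmodChar_primitive_of_primitive_root _ (IsPrimitiveRoot.orderOf ξ)
  have h0 := sum_range_zpow_eq_zmod hξ b 0
  simp only [zero_mul, add_zero, Int.cast_zero] at h0
  rw [h0, sum_range_zpow_eq_zmod hξ]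
  by_cases hex : ∃ h : ℤ, (b * h : ZMod (orderOf ξ)) = j
  · obtain ⟨h, hh⟩ := hex
    have hh' : ξ ^ (b * h) = ξ ^ j := by
      rw [← zmodChar_intCast hξ, ← zmodChar_intCast hξ, ← hh, Int.cast_mul]
    rw [gaussSum_shift _ hh, gaussVal_of_zpow_eq hh', ← zmodChar_intCast hξ]
    simp
  · push Not at hex
    rw [gaussSum_eq_zero hr hψ, gaussVal_eq_zero, zero_mul]
    · intro h hh
      apply hex h
      have h1 : ξ ^ (b * h - j) = 1 := by
        have hξ0 : ξ ≠ 0 := by rintro rfl; simp at hr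
        rw [zpow_sub₀ hξ0, hh, div_self (zpow_ne_zero _ hξ0)]
      have h2 := (ZMod.intCast_zmod_eq_zero_iff_dvd _ _).2 (((IsPrimitiveRoot.orderOf ξ).zpow_eq_one_iff_dvd _).1 h1)
      push_cast at h2
      linear_combination h2
    · intro h
      obtain ⟨h, rfl⟩ := ZMod.intCast_surjective h
      exact hex h

theorem gaussSum_range_ne_zero {ξ : ℂ} (hr : Odd (orderOf ξ)) (b : ℤ) :
    ∑ m ∈ Finset.range (orderOf ξ), ξ ^ (b * (m * (m + 1)) : ℤ) ≠ 0 := by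
  have : NeZero (orderOf ξ) := ⟨hr.pos.ne'⟩
  have hψ := AddChar.zmodChar_primitive_of_primitive_root _ (IsPrimitiveRoot.orderOf ξ)
  have h0 := sum_range_zpow_eq_zmod (pow_orderOf_eq_one ξ) b 0
  simp only [zero_mul, add_zero, Int.cast_zero] at h0
  rw [h0]
  exact gaussSum_ne_zero hr hψ _

/-! ### Lifting the normalised Gauss sums to polynomials -/

theorem pow_sub_one_dvd_of_dvd {R : Type*} [CommRing R] (x : R) {m n : ℕ} (h : m ∣ n) :
    x ^ m - 1 ∣ x ^ n - 1 := by
  obtain ⟨i, rfl⟩ := h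
  rw [pow_mul]
  simpa using sub_dvd_pow_sub_pow (x ^ m) 1 i

section Lift

variable {K : Type*} [CommRing K] [Algebra K ℂ] [FaithfulSMul K ℂ]

theorem map_dvd_map_complex {f g : K[X]} (hf : f.Monic)
    (h : f.map (algebraMap K ℂ) ∣ g.map (algebraMap K ℂ)) : f ∣ g :=
  (map_dvd_map _ (FaithfulSMul.algebraMap_injective K ℂ) hf).1 h

theorem X_pow_sub_one_dvd_of_forall_root {F : Type*} [Field F] {N : ℕ} {ζ : F}
    (hζ : IsPrimitiveRoot ζ N) (hN : 0 < N) {f : F[X]} (h : ∀ ξ : F, ξ ^ N = 1 → f.eval ξ = 0) :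
    X ^ N - 1 ∣ f := by
  rw [X_pow_sub_one_eq_prod hN hζ]
  refine Finset.prod_dvd_of_coprime ?_ fun ξ hξ => ?_
  · intro x _ y _ hxy
    exact isCoprime_X_sub_C_of_isUnit_sub (sub_ne_zero.2 hxy).isUnit
  · rw [dvd_iff_isRoot]
    exact h ξ ((mem_nthRootsFinset hN _).1 hξ)

theorem X_pow_sub_one_dvd_of_aeval {N : ℕ} (hN : 0 < N) {f : K[X]}
    (h : ∀ ξ : ℂ, ξ ^ N = 1 → aeval ξ f = 0) : X ^ N - 1 ∣ f := by
  refine map_dvd_map_complex (monic_X_pow_sub_C 1 hN.ne') ?_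
  simp only [Polynomial.map_sub, Polynomial.map_pow, map_X, Polynomial.map_one]
  refine X_pow_sub_one_dvd_of_forall_root (Complex.isPrimitiveRoot_exp N hN.ne') hN fun ξ hξ => ?_
  rw [eval_map_algebraMap]
  exact h ξ hξ

theorem zpow_eq_pow_emod {N : ℕ} (hN : 0 < N) {ξ : ℂ} (hξ : ξ ^ N = 1) (n : ℤ) :
    ξ ^ n = ξ ^ (n % N).toNat := by
  have hξ0 : ξ ≠ 0 := by rintro rfl; simp [hN.ne'] at hξ
  rw [← zpow_natCast, Int.toNat_of_nonneg (Int.emod_nonneg _ (by omega))]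
  conv_lhs => rw [← Int.emod_add_mul_ediv n N, zpow_add₀ hξ0, zpow_mul, zpow_natCast, hξ, one_zpow,
    mul_one]

theorem zpow_eq_one_of_dvd {N : ℕ} {ξ : ℂ} (hξ : ξ ^ N = 1) {n : ℤ} (h : (N : ℤ) ∣ n) :
    ξ ^ n = 1 := by
  obtain ⟨m, rfl⟩ := h
  rw [zpow_mul, zpow_natCast, hξ, one_zpow]

-- Let v be the p-adic valuation of j and N' the prime-to-p part of N. If v < l, the congruence is
-- solvable exactly when ξ^(N' p^v) = 1. Averaging the powers of ξ^(N' p^v) gives the indicator of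
-- this condition, and needs only division by a power of p.
omit [FaithfulSMul K ℂ] in
theorem exists_aeval_eq_gaussVal {p l : ℕ} (hp : p.Prime) (hunit : IsUnit ((p ^ l : ℕ) : K))
    {s : ℤ} (hs : s * s = 1) {N : ℕ} (hN : 0 < N) (hlN : p ^ l ∣ N) (j : ℤ) :
    ∃ E : K[X], ∀ ξ : ℂ, ξ ^ N = 1 → aeval ξ E = gaussVal (s * (p ^ l : ℕ)) j ξ := by
  by_cases hj : ((p ^ l : ℕ) : ℤ) ∣ j
  · obtain ⟨i, rfl⟩ := hj
    refine ⟨X ^ (-((p ^ l : ℕ) * i * (s * i)) % (N : ℤ)).toNat, fun ξ hξ => ?_⟩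
    rw [gaussVal_of_zpow_eq (h := s * i), map_pow, aeval_X, ← zpow_eq_pow_emod hN hξ]
    congr 1
    linear_combination ((p ^ l : ℕ) : ℤ) * i * hs
  have hj0 : j.natAbs ≠ 0 := by
    rintro h
    exact hj (by simp [Int.natAbs_eq_zero.1 h])
  obtain ⟨v, n, hn, hv⟩ := Nat.exists_eq_pow_mul_and_not_dvd hj0 p hp.ne_one
  have hvj : (p : ℤ) ^ v ∣ j := by
    rw [← Int.dvd_natAbs, hv]; push_cast; exact dvd_mul_right _ _
  have hvj' : ¬ (p : ℤ) ^ (v + 1) ∣ j := by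
    rw [← Int.dvd_natAbs, hv, pow_succ]
    intro h
    have h' : p ^ v * p ∣ p ^ v * n := by exact_mod_cast h
    exact hn (Nat.dvd_of_mul_dvd_mul_left (pow_pos hp.pos v) h')
  have hvl : v < l := by
    by_contra! hlv
    apply hj
    push_cast
    exact (pow_dvd_pow _ hlv).trans hvj
  obtain ⟨t, N', hN', ht⟩ := Nat.exists_eq_pow_mul_and_not_dvd hN.ne' p hp.ne_one
  have hlt : l ≤ t := by
    rw [ht] at hlN
    have h1 : Nat.Coprime (p ^ l) N' := Nat.Coprime.pow_left _ ((hp.coprime_iff_not_dvd).2 hN')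
    exact (Nat.pow_dvd_pow_iff_le_right hp.one_lt).1 (h1.dvd_of_dvd_mul_right hlN)
  have hpu : IsUnit (p : K) := by
    rw [Nat.cast_pow] at hunit
    exact (isUnit_pow_iff (by omega)).1 hunit
  obtain ⟨c, hc⟩ := (hpu.pow (t - v)).exists_left_inv
  have hcop : IsCoprime (s * (p ^ l : ℕ)) (N' : ℤ) := by
    have h1 : IsCoprime s (N' : ℤ) := ⟨s, 0, by rw [hs]; ring⟩
    refine h1.mul_left ?_
    exact Nat.isCoprime_iff_coprime.2 (Nat.Coprime.pow_left _ ((hp.coprime_iff_not_dvd).2 hN'))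
  obtain ⟨u, w, huw⟩ := hcop
  -- Here u inverts s p^l modulo N', so h = u j is a solution whenever one exists; the second factor
  -- is the averaging idempotent.
  refine ⟨X ^ (-(u * j ^ 2) % (N : ℤ)).toNat *
    (C c * ∑ x ∈ Finset.range (p ^ (t - v)), X ^ (N' * p ^ v * x)), fun ξ hξ => ?_⟩
  have hξ0 : ξ ≠ 0 := by rintro rfl; simp [hN.ne'] at hξ
  have hc' : algebraMap K ℂ c * (p : ℂ) ^ (t - v) = 1 := by
    simpa using congrArg (algebraMap K ℂ) hc
  simp only [map_mul, map_pow, aeval_X, aeval_C, map_sum]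
  rw [← zpow_eq_pow_emod hN hξ]
  simp_rw [pow_mul ξ (N' * p ^ v)]
  by_cases hy : ξ ^ (N' * p ^ v) = 1
  · rw [hy, gaussVal_of_zpow_eq (h := u * j)]
    · simp only [one_pow, Finset.sum_const, Finset.card_range, nsmul_eq_mul, mul_one, Nat.cast_pow]
      rw [hc', mul_one]
      congr 1
      ring
    · have h1 : s * (p ^ l : ℕ) * (u * j) = j + -(w * (N' * j)) := by linear_combination j * huw
      rw [h1, zpow_add₀ hξ0, zpow_eq_one_of_dvd hy (n := -(w * (N' * j))) ?_, mul_one]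
      push_cast
      exact (((mul_dvd_mul_left _ hvj)).mul_left _).neg_right
  · have hgeom := geom_sum_mul (ξ ^ (N' * p ^ v)) (p ^ (t - v))
    rw [← pow_mul ξ, mul_assoc, ← pow_add, Nat.add_sub_cancel' (by omega), mul_comm N' (p ^ t), ← ht, hξ,
      sub_self] at hgeom
    rw [(mul_eq_zero.1 hgeom).resolve_right (sub_ne_zero.2 hy), mul_zero, mul_zero,
      gaussVal_eq_zero]
    intro h hh
    have h1 : (ξ ^ N') ^ (s * (p ^ l : ℕ) * h - j) = 1 := by
      rw [zpow_sub₀ (pow_ne_zero _ hξ0), ← zpow_natCast, ← zpow_mul, ← zpow_mul, mul_comm, zpow_mul,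
        hh, ← zpow_mul, mul_comm j, div_self (zpow_ne_zero _ hξ0)]
    have h2 : orderOf (ξ ^ N') ∣ p ^ t := by
      rw [orderOf_dvd_iff_pow_eq_one, ← pow_mul, mul_comm, ← ht, hξ]
    obtain ⟨i, -, hi⟩ := (Nat.dvd_prime_pow hp).1 h2
    have h3 := ((IsPrimitiveRoot.orderOf (ξ ^ N')).zpow_eq_one_iff_dvd _).1 h1
    have hvi : v + 1 ≤ i := by
      by_contra! hlt
      apply hy
      rw [pow_mul, ← orderOf_dvd_iff_pow_eq_one, hi]
      exact pow_dvd_pow _ (by omega)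
    rw [hi] at h3
    push_cast at h3
    apply hvj'
    have h4 := (pow_dvd_pow (p : ℤ) hvi).trans h3
    have h5 : (p : ℤ) ^ (v + 1) ∣ s * p ^ l * h :=
      ((pow_dvd_pow (p : ℤ) hvl).mul_left s).mul_right h
    simpa using (dvd_sub h5 h4)

/-- `E` lifts `ξ ↦ gaussVal (s B) j ξ` from the `N`-th roots of unity to a root of
`q^(s j²) Y^(B + 1) = Y` modulo `(q^N - 1)^M`. -/
def IsGaussLift (s : ℤ) (B : ℕ) (j : ℤ) (N M : ℕ) (E : K[X]) : Prop :=
  (∀ ξ : ℂ, ξ ^ N = 1 → aeval ξ E = gaussVal (s * B) j ξ) ∧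
    (X ^ N - 1) ^ M ∣ X ^ (s * j ^ 2).toNat * E ^ (B + 1) - X ^ (-(s * j ^ 2)).toNat * E

abbrev LevelQuot (K : Type*) [CommRing K] (N M : ℕ) : Type _ :=
  K[X] ⧸ Ideal.span {((X : K[X]) ^ N - 1) ^ M}

theorem isNilpotent_mk_of_aeval {N : ℕ} (hN : 0 < N) (M : ℕ) {f : K[X]}
    (h : ∀ ξ : ℂ, ξ ^ N = 1 → aeval ξ f = 0) :
    IsNilpotent (Ideal.Quotient.mk (Ideal.span {((X : K[X]) ^ N - 1) ^ M}) f) := by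
  refine ⟨M, ?_⟩
  rw [← map_pow, Ideal.Quotient.eq_zero_iff_mem, Ideal.mem_span_singleton]
  exact pow_dvd_pow_of_dvd (X_pow_sub_one_dvd_of_aeval hN h) M

omit [FaithfulSMul K ℂ] in
theorem aeval_eq_zero_of_isNilpotent_mk {N M : ℕ} (hM : M ≠ 0) {f : K[X]}
    (h : IsNilpotent (Ideal.Quotient.mk (Ideal.span {((X : K[X]) ^ N - 1) ^ M}) f)) {ξ : ℂ}
    (hξ : ξ ^ N = 1) : aeval ξ f = 0 := by
  obtain ⟨n, hn⟩ := h
  rw [← map_pow, Ideal.Quotient.eq_zero_iff_mem, Ideal.mem_span_singleton] at hn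
  obtain ⟨g, hg⟩ := hn
  have h1 := congrArg (aeval ξ) hg
  simp only [map_pow, map_mul, map_sub, aeval_X, map_one, hξ, sub_self, zero_pow hM, zero_mul] at h1
  exact eq_zero_of_pow_eq_zero h1

/-- Newton's method in a nilpotent thickening of the N-th roots of unity. The derivative of q^a
Y^(B+1) - q^(a') Y is -q^(a') at a zero value and B q^(a') at a nonzero one, a unit in both cases.
-/
theorem gaussLift_newton {s : ℤ} (hs : s * s = 1) {B : ℕ} (hB : 0 < B) (hunit : IsUnit (B : K))
    {j : ℤ} {N M : ℕ} (hN : 0 < N) {E : K[X]}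
    (hE : ∀ ξ : ℂ, ξ ^ N = 1 → aeval ξ E = gaussVal (s * B) j ξ) :
    ∃! r : LevelQuot K N M, IsNilpotent (Ideal.Quotient.mk _ E - r) ∧
      Ideal.Quotient.mk _ (X ^ (s * j ^ 2).toNat) * r ^ (B + 1) -
        Ideal.Quotient.mk _ (X ^ (-(s * j ^ 2)).toNat) * r = 0 := by
  set a := (s * j ^ 2).toNat
  set a' := (-(s * j ^ 2)).toNat
  have haa : (a : ℤ) - a' = s * j ^ 2 := by omega
  set π : K[X] →+* LevelQuot K N M := Ideal.Quotient.mk _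
  let P : (LevelQuot K N M)[X] := C (π (X ^ a)) * X ^ (B + 1) - C (π (X ^ a')) * X
  have hP : ∀ r, aeval r P = π (X ^ a) * r ^ (B + 1) - π (X ^ a') * r := by
    intro r; simp [P]
  have hP' : ∀ r, aeval r (derivative P) = π (X ^ a) * ((B + 1) * r ^ B) - π (X ^ a') := by
    intro r; simp [P, -map_pow]
  simp_rw [← hP]
  have hval : ∀ ξ : ℂ, ξ ^ N = 1 → aeval ξ E = 0 ∨ ξ ^ a * aeval ξ E ^ B = ξ ^ a' := by
    intro ξ hξ
    have hξ0 : ξ ≠ 0 := by rintro rfl; simp [hN.ne'] at hξ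
    rw [hE ξ hξ]
    refine (gaussVal_eq_zero_or_pow hs B j ξ).imp_right fun h => ?_
    rw [h, ← zpow_natCast, ← zpow_natCast, ← zpow_add₀ hξ0]
    congr 1
    omega
  refine existsUnique_nilpotent_sub_and_aeval_eq_zero ?_ ?_
  · rw [hP, ← map_pow, ← map_mul, ← map_mul, ← map_sub]
    refine isNilpotent_mk_of_aeval hN M fun ξ hξ => ?_
    simp only [map_sub, map_mul, map_pow, aeval_X, pow_succ]
    rcases hval ξ hξ with h | h
    · simp [h]
    · linear_combination aeval ξ E * h
  · obtain ⟨c, hc⟩ := hunit.exists_left_inv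
    have hc' : algebraMap K ℂ c * (B : ℂ) = 1 := by simpa using congrArg (algebraMap K ℂ) hc
    -- An inverse of the derivative modulo nilpotents: X^((N-1) a') stands for q^(-a'), so the
    -- values are -q^(-a') where E vanishes and q^(-a')/B elsewhere.
    let W : K[X] := X ^ ((N - 1) * a') * (X ^ ((N - 1) * a' + a) * E ^ B * (C c + 1) - 1)
    have hW : IsUnit (π ((X ^ a * (((B : K[X]) + 1) * E ^ B) - X ^ a') * W)) := by
      have h1 : IsNilpotent (π ((X ^ a * (((B : K[X]) + 1) * E ^ B) - X ^ a') * W - 1)) := by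
        refine isNilpotent_mk_of_aeval hN M fun ξ hξ => ?_
        have hx : ξ ^ ((N - 1) * a') * ξ ^ a' = 1 := by
          rw [← pow_add, ← Nat.succ_mul, Nat.succ_eq_add_one, Nat.sub_add_cancel hN, pow_mul, hξ,
            one_pow]
        simp only [W, map_sub, map_mul, map_pow, aeval_X, map_add, map_one, aeval_C, map_natCast,
          pow_add]
        rcases hval ξ hξ with h | h
        · rw [h, zero_pow hB.ne']
          linear_combination hx
        · set y := ξ ^ ((N - 1) * a')
          set e := aeval ξ E ^ B
          set cc := (algebraMap K ℂ) c
          have h2 : y * ξ ^ a * e = 1 := by rw [mul_assoc, h, hx]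
          have h3 : ξ ^ a * ((B + 1) * e) - ξ ^ a' = B * ξ ^ a' := by
            linear_combination ((B : ℂ) + 1) * h
          rw [h3, h2]
          linear_combination hc' + B * cc * hx
      have h2 := IsNilpotent.isUnit_one_add h1
      rwa [map_sub, map_one, add_sub_cancel] at h2
    rw [map_mul] at hW
    have h3 := isUnit_of_mul_isUnit_left hW
    rw [hP']
    simpa using h3

theorem exists_isGaussLift {s : ℤ} (hs : s * s = 1) {p l : ℕ} (hp : p.Prime)
    (hunit : IsUnit ((p ^ l : ℕ) : K)) {N M : ℕ} (hN : 0 < N) (hlN : p ^ l ∣ N) (hM : M ≠ 0)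
    (j : ℤ) : ∃ E : K[X], IsGaussLift s (p ^ l) j N M E := by
  obtain ⟨E₀, h₀⟩ := exists_aeval_eq_gaussVal hp hunit hs hN hlN j
  obtain ⟨r, ⟨hr, hr0⟩, -⟩ := gaussLift_newton (M := M) hs (pow_pos hp.pos l) hunit hN h₀
  obtain ⟨E, rfl⟩ := Ideal.Quotient.mk_surjective r
  refine ⟨E, fun ξ hξ => ?_, ?_⟩
  · rw [← map_sub] at hr
    have := aeval_eq_zero_of_isNilpotent_mk hM hr hξ
    rw [map_sub, sub_eq_zero] at this
    rw [← this, h₀ ξ hξ]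
  · rwa [← map_pow, ← map_mul, ← map_mul, ← map_sub, Ideal.Quotient.eq_zero_iff_mem,
      Ideal.mem_span_singleton] at hr0

theorem IsGaussLift.dvd_sub {s : ℤ} (hs : s * s = 1) {B : ℕ} (hB : 0 < B) (hunit : IsUnit (B : K))
    {j : ℤ} {N M : ℕ} (hN : 0 < N) {E E' : K[X]} (hE : IsGaussLift s B j N M E)
    (hE' : IsGaussLift s B j N M E') : (X ^ N - 1) ^ M ∣ E - E' := by
  have hu := gaussLift_newton (M := M) hs hB hunit hN hE.1
  rw [← Ideal.mem_span_singleton, ← Ideal.Quotient.eq]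
  refine hu.unique ⟨by simp, ?_⟩ ⟨?_, ?_⟩
  · rw [← map_pow, ← map_mul, ← map_mul, ← map_sub, Ideal.Quotient.eq_zero_iff_mem,
      Ideal.mem_span_singleton]
    exact hE.2
  · rw [← map_sub]
    refine isNilpotent_mk_of_aeval hN M fun ξ hξ => ?_
    rw [map_sub, hE.1 ξ hξ, hE'.1 ξ hξ, sub_self]
  · rw [← map_pow, ← map_mul, ← map_mul, ← map_sub, Ideal.Quotient.eq_zero_iff_mem,
      Ideal.mem_span_singleton]
    exact hE'.2

omit [FaithfulSMul K ℂ] in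
theorem IsGaussLift.mono {s : ℤ} {B : ℕ} {j : ℤ} {N M N' M' : ℕ} (hN : N ∣ N') (hM : M ≤ M')
    {E : K[X]} (hE : IsGaussLift s B j N' M' E) : IsGaussLift s B j N M E := by
  refine ⟨fun ξ hξ => hE.1 ξ ?_, dvd_trans ?_ hE.2⟩
  · obtain ⟨m, rfl⟩ := hN
    rw [pow_mul, hξ, one_pow]
  · exact (pow_dvd_pow_of_dvd (pow_sub_one_dvd_of_dvd X hN) M).trans (pow_dvd_pow _ hM)

end Lift

/-! ### The differential equation of the lifts -/

theorem X_mul_derivative_X_pow {R : Type*} [CommRing R] (a : ℕ) :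
    (X : R[X]) * derivative (X ^ a) = (a : R[X]) * X ^ a := by
  cases a with
  | zero => simp
  | succ a => rw [derivative_X_pow, add_tsub_cancel_right, map_natCast]; ring

/-- Logarithmic differentiation would need E invertible. Instead e = q^(s j²) E^B is an idempotent
with e E = E; comparing the differentiated equation with its multiple by e gives e E' = E' up to the
unit q, and then the claim. -/
theorem IsGaussLift.dvd_derivative {K : Type*} [CommRing K] [Algebra K ℂ] {s : ℤ} {B : ℕ}
    (hB : 0 < B) {j : ℤ} {N M : ℕ} (hN : 0 < N) {E : K[X]} (hE : IsGaussLift s B j N M E) :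
    (X ^ N - 1) ^ (M - 1) ∣ (B : K[X]) * (X * derivative E) + ((s * j ^ 2 : ℤ) : K[X]) * E := by
  obtain ⟨-, h⟩ := hE
  have haa : ((s * j ^ 2).toNat : ℤ) - (-(s * j ^ 2)).toNat = s * j ^ 2 := by omega
  set a := (s * j ^ 2).toNat
  set a' := (-(s * j ^ 2)).toNat
  have h1 := (pow_sub_one_dvd_derivative_of_pow_dvd h).mul_left X
  have h0 := (pow_dvd_pow _ (Nat.sub_le M 1)).trans h
  set m : K[X] := (X ^ N - 1) ^ (M - 1) with hm
  have hX : IsUnit (Ideal.Quotient.mk (Ideal.span {m}) X) := by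
    have h3 : (X : K[X]) ∣ 1 - (1 - X ^ N) ^ (M - 1) := by
      have h4 := sub_dvd_pow_sub_pow (1 : K[X]) (1 - X ^ N) (M - 1)
      rw [one_pow, sub_sub_cancel] at h4
      exact (dvd_pow_self X hN.ne').trans h4
    obtain ⟨g, hg⟩ := h3
    refine IsUnit.of_mul_eq_one (Ideal.Quotient.mk _ g) ?_
    rw [← map_mul, ← hg, map_sub, map_one, sub_eq_self, Ideal.Quotient.eq_zero_iff_mem,
      Ideal.mem_span_singleton, hm, show (1 - X ^ N : K[X]) = -(X ^ N - 1) by ring, neg_pow]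
    exact dvd_mul_left _ _
  obtain ⟨y, hy⟩ := (hX.pow a').exists_left_inv
  have h4 : X * derivative (X ^ a * E ^ (B + 1) - X ^ a' * E) =
      (a : K[X]) * X ^ a * E ^ (B + 1) + ((B : K[X]) + 1) * X ^ a * E ^ B * (X * derivative E) -
        ((a' : K[X]) * X ^ a' * E + X ^ a' * (X * derivative E)) := by
    have e1 := X_mul_derivative_X_pow (R := K) a
    have e2 := X_mul_derivative_X_pow (R := K) a'
    rw [derivative_sub, derivative_mul, derivative_mul, derivative_pow_succ]
    simp only [map_add, map_natCast, map_one]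
    linear_combination E ^ (B + 1) * e1 - E * e2
  rw [h4] at h1
  rw [← Ideal.mem_span_singleton, ← Ideal.Quotient.eq_zero_iff_mem] at h0 h1 ⊢
  simp only [map_add, map_sub, map_mul, map_pow, map_natCast, map_one, map_intCast] at h0 h1 ⊢
  rw [← haa]
  push_cast
  set x := Ideal.Quotient.mk (Ideal.span {m}) X
  set f := Ideal.Quotient.mk (Ideal.span {m}) E
  set f' := Ideal.Quotient.mk (Ideal.span {m}) (derivative E)
  clear_value x f f' a a'
  obtain ⟨B, rfl⟩ : ∃ B', B = B' + 1 := ⟨B - 1, by omega⟩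
  have hef : y * x ^ a * f ^ (B + 1) * f = f := by linear_combination y * h0 + f * hy
  set e := y * x ^ a * f ^ (B + 1) with he
  have hee : e * e = e := by
    conv_lhs => rw [he]
    conv_rhs => rw [he]
    rw [pow_succ]
    linear_combination (y * x ^ a * f ^ B) * hef
  push_cast at h1 ⊢
  have k1 : (a - a') * f + (B + 2) * e * (x * f') - x * f' = 0 := by
    rw [he] at *
    linear_combination y * h1 - a * hef + (a' * f + x * f') * hy
  have k2 : (a - a') * f + (B + 1) * e * (x * f') = 0 := by
    linear_combination e * k1 - (B + 2) * (x * f') * hee - (a - a') * hef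
  linear_combination (B + 1) * (k2 - k1) + k2

/-! ### The heat operator and orders of vanishing -/

section Multiplicity

theorem derivation_mem_pow {R A : Type*} [CommRing R] [CommRing A] [Algebra R A]
    (δ : Derivation R A A) (I : Ideal A) (n : ℕ) {f : A} (hf : f ∈ I ^ (n + 1)) : δ f ∈ I ^ n := by
  induction n generalizing f with
  | zero => simp
  | succ n ih =>
    rw [pow_succ] at hf
    refine Submodule.mul_induction_on hf (fun a ha b hb => ?_) fun a b ha hb => ?_
    · rw [Derivation.leibniz, smul_eq_mul, smul_eq_mul]
      refine add_mem (Ideal.mul_mem_right _ _ ha) ?_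
      rw [pow_succ, mul_comm b]
      exact Ideal.mul_mem_mul (ih ha) hb
    · rw [map_add]
      exact add_mem ha hb

theorem prod_mem_pow_card {A ι : Type*} [CommRing A] (I : Ideal A) (t : Finset ι) (f : ι → A)
    (P : ι → Prop) [DecidablePred P] (h : ∀ i ∈ t, P i → f i ∈ I) :
    ∏ i ∈ t, f i ∈ I ^ (t.filter P).card := by
  rw [← Finset.prod_filter_mul_prod_filter_not t P, ← Finset.prod_const]
  refine Ideal.mul_mem_right _ _ (Ideal.prod_mem_prod fun i hi => ?_)
  exact h i (Finset.mem_filter.1 hi).1 (Finset.mem_filter.1 hi).2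

/-- The Euler operator `q ∂/∂q`. -/
def eulerDer (R : Type*) [CommRing R] : Derivation R R[X] R[X] := (X : R[X]) • derivative'

theorem eulerDer_apply {R : Type*} [CommRing R] (f : R[X]) : eulerDer R f = X * derivative f := rfl

/-- The operator `q ∂/∂q` on polynomials in `z` over `R[q]`. -/
def eulerDerCoeff (R : Type*) [CommRing R] : Derivation R R[X][X] R[X][X] :=
  PolynomialModule.equivPolynomialSelf.toLinearMap.compDer (eulerDer R).mapCoeffs

theorem coeff_eulerDerCoeff {R : Type*} [CommRing R] (p : R[X][X]) (m : ℕ) :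
    (eulerDerCoeff R p).coeff m = eulerDer R (p.coeff m) := rfl

theorem coeff_eulerDer {R : Type*} [CommRing R] (p : R[X]) (m : ℕ) :
    (eulerDer R p).coeff m = m * p.coeff m := by
  rw [eulerDer_apply]
  cases m with
  | zero => simp
  | succ m => simp [coeff_derivative, mul_comm]

/-- The shifted Euler operator `z^m ↦ (m - k) z^m`. -/
def shiftedEuler (k : ℕ) (p : ℂ[X][X]) : ℂ[X][X] := eulerDer ℂ[X] p - (k : ℂ[X][X]) * p

/-- The heat operator intertwined by the Laplace transform with `B q ∂/∂q`. -/
def heatOp (s : ℤ) (B k : ℕ) (p : ℂ[X][X]) : ℂ[X][X] :=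
  (B : ℂ[X][X]) * eulerDerCoeff ℂ p - (s : ℂ[X][X]) * shiftedEuler k (shiftedEuler k p)

theorem coeff_shiftedEuler (k : ℕ) (p : ℂ[X][X]) (m : ℕ) :
    (shiftedEuler k p).coeff m = ((m : ℂ[X]) - k) * p.coeff m := by
  rw [shiftedEuler, coeff_sub, coeff_eulerDer, coeff_natCast_mul]
  ring

theorem coeff_heatOp (s : ℤ) (B k : ℕ) (p : ℂ[X][X]) (m : ℕ) :
    (heatOp s B k p).coeff m =
      B * eulerDer ℂ (p.coeff m) - s * ((m : ℂ[X]) - k) ^ 2 * p.coeff m := by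
  rw [heatOp, coeff_sub, coeff_natCast_mul, coeff_intCast_mul, coeff_shiftedEuler,
    coeff_shiftedEuler, coeff_eulerDerCoeff]
  ring

theorem shiftedEuler_mem_pow (k : ℕ) (I : Ideal ℂ[X][X]) (n : ℕ) {p : ℂ[X][X]}
    (hp : p ∈ I ^ (n + 1)) : shiftedEuler k p ∈ I ^ n :=
  sub_mem (derivation_mem_pow _ I n hp) (Ideal.mul_mem_left _ _ (Ideal.pow_le_pow_right n.le_succ hp))

theorem heatOp_mem_pow (s : ℤ) (B k : ℕ) (I : Ideal ℂ[X][X]) (n : ℕ) {p : ℂ[X][X]}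
    (hp : p ∈ I ^ (n + 2)) : heatOp s B k p ∈ I ^ n :=
  sub_mem (Ideal.mul_mem_left _ _ (derivation_mem_pow _ I n
      (Ideal.pow_le_pow_right (n + 1).le_succ hp)))
    (Ideal.mul_mem_left _ _ (shiftedEuler_mem_pow k I n (shiftedEuler_mem_pow k I (n + 1) hp)))

theorem heatOp_iterate_mem (s : ℤ) (B k : ℕ) (I : Ideal ℂ[X][X]) (i n : ℕ) {p : ℂ[X][X]}
    (hp : p ∈ I ^ (2 * i + n)) : (heatOp s B k)^[i] p ∈ I ^ n := by
  induction i generalizing p with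
  | zero => simpa using hp
  | succ i ih =>
    rw [Function.iterate_succ_apply]
    refine ih (heatOp_mem_pow s B k I _ ?_)
    convert hp using 2
    ring

/-- The `R[q]`-linear Laplace transform `z^m ↦ E (m - k)`. -/
def laplace {R : Type*} [CommRing R] (k : ℕ) (E : ℤ → R[X]) (p : R[X][X]) : R[X] :=
  p.sum fun m c => c * E (m - k)

theorem laplace_eq_sum_range {R : Type*} [CommRing R] (k : ℕ) (E : ℤ → R[X]) (p : R[X][X]) {n : ℕ}
    (hn : p.natDegree < n) : laplace k E p = ∑ m ∈ Finset.range n, p.coeff m * E (m - k) :=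
  sum_over_range' _ (by simp) n hn

/-- Leibniz on c · E(m - k): the differential equation turns the term with E' into -s (m - k)² c E(m
- k), and (m - k)² is the eigenvalue of the squared shifted Euler operator on z^m. -/
theorem laplace_heatOp (s : ℤ) (B k : ℕ) (E : ℤ → ℂ[X]) (m : ℂ[X])
    (hE : ∀ j, m ∣ (B : ℂ[X]) * (X * derivative (E j)) + ((s * j ^ 2 : ℤ) : ℂ[X]) * E j)
    (p : ℂ[X][X]) :
    m ∣ B * eulerDer ℂ (laplace k E p) - laplace k E (heatOp s B k p) := by
  have hdeg : (heatOp s B k p).natDegree < p.natDegree + 1 := by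
    rw [Nat.lt_succ_iff, natDegree_le_iff_coeff_eq_zero]
    intro i hi
    rw [coeff_heatOp, coeff_eq_zero_of_natDegree_lt hi]
    simp
  rw [laplace_eq_sum_range k E _ hdeg, laplace_eq_sum_range k E p (Nat.lt_succ_self _), map_sum,
    Finset.mul_sum, ← Finset.sum_sub_distrib]
  refine Finset.dvd_sum fun i _ => ?_
  rw [coeff_heatOp, Derivation.leibniz, smul_eq_mul, smul_eq_mul, eulerDer_apply (E _)]
  have h := (hE (i - k)).mul_left (p.coeff i)
  convert h using 1
  push_cast
  ring

theorem iterate_euler_laplace (s : ℤ) (B k : ℕ) (E : ℤ → ℂ[X]) (m : ℂ[X]) (n : ℕ)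
    (hE : ∀ j, m ^ n ∣ (B : ℂ[X]) * (X * derivative (E j)) + ((s * j ^ 2 : ℤ) : ℂ[X]) * E j)
    (p : ℂ[X][X]) (i : ℕ) :
    m ^ (n + 1 - i) ∣
      (fun f => (B : ℂ[X]) * eulerDer ℂ f)^[i] (laplace k E p) -
        laplace k E ((heatOp s B k)^[i] p) := by
  induction i with
  | zero => simp
  | succ i ih =>
    rw [Function.iterate_succ_apply', Function.iterate_succ_apply']
    set f := (fun f => (B : ℂ[X]) * eulerDer ℂ f)^[i] (laplace k E p)
    set g := (heatOp s B k)^[i] p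
    have h1 : m ^ (n + 1 - (i + 1)) ∣ B * eulerDer ℂ (f - laplace k E g) := by
      rw [eulerDer_apply]
      have := pow_sub_one_dvd_derivative_of_pow_dvd ih
      rw [show n + 1 - (i + 1) = n + 1 - i - 1 by omega]
      exact (this.mul_left _).mul_left _
    have h2 := (pow_dvd_pow m (show n + 1 - (i + 1) ≤ n by omega)).trans
      (laplace_heatOp s B k E (m ^ n) hE g)
    have h3 := dvd_add h1 h2
    rw [map_sub] at h3
    convert h3 using 1
    ring

end Multiplicity

/-- In characteristic zero differentiation lowers the multiplicity of a root by exactly one, and B q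
is coprime to q - ξ. -/
theorem pow_dvd_of_iterate_euler {B : ℕ} (hB : 0 < B) {ξ : ℂ} (hξ : ξ ≠ 0) (m : ℕ) (f : ℂ[X])
    (h : ∀ i < m, ((fun f => (B : ℂ[X]) * eulerDer ℂ f)^[i] f).eval ξ = 0) :
    (X - C ξ) ^ m ∣ f := by
  induction m generalizing f with
  | zero => simp
  | succ m ih =>
    by_cases hf : f = 0
    · simp [hf]
    have h0 : f.IsRoot ξ := h 0 m.succ_pos
    have h1 := ih ((B : ℂ[X]) * eulerDer ℂ f) fun i hi => by
      rw [← Function.iterate_succ_apply (fun f => (B : ℂ[X]) * eulerDer ℂ f)]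
      exact h (i + 1) (by omega)
    have hc : IsCoprime ((X - C ξ) ^ m) ((B : ℂ[X]) * X) := by
      refine IsCoprime.pow_left (IsCoprime.mul_right ?_ ?_)
      · have hu : IsUnit ((B : ℂ[X])) := by
          rw [← map_natCast (C : ℂ →+* ℂ[X])]
          exact (isUnit_iff_ne_zero.2 (by exact_mod_cast hB.ne')).map C
        exact by
          obtain ⟨v, hv⟩ := hu.exists_left_inv
          exact ⟨0, v, by rw [hv]; ring⟩
      · simpa using isCoprime_X_sub_C_of_isUnit_sub (sub_ne_zero.2 hξ).isUnit
    rw [eulerDer_apply, ← mul_assoc] at h1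
    have h2 := hc.dvd_of_dvd_mul_left h1
    have hf' : derivative f ≠ 0 := by
      intro e
      obtain ⟨c, rfl⟩ := natDegree_eq_zero.1 (derivative_eq_zero.1 e)
      rw [IsRoot, eval_C] at h0
      exact hf (by rw [h0, C_0])
    rw [← le_rootMultiplicity_iff hf'] at h2
    rw [← le_rootMultiplicity_iff hf]
    have h3 := derivative_rootMultiplicity_of_root h0
    have h4 := (rootMultiplicity_pos hf).2 h0
    omega

/-- At q = ξ the transform is a linear functional on ℂ[z]; periodicity of its moments makes it kill
the ideal generated by z^d - 1. -/
theorem eval_laplace_eq_zero {k d : ℕ} {E : ℤ → ℂ[X]} {ξ : ℂ}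
    (hE : ∀ j, (E (j + d)).eval ξ = (E j).eval ξ) {p : ℂ[X][X]}
    (hp : X ^ d - 1 ∣ p.map (evalRingHom ξ)) : (laplace k E p).eval ξ = 0 := by
  let Λ : ℂ[X] →ₗ[ℂ] ℂ :=
    Polynomial.lsum fun m => (E (m - k)).eval ξ • (LinearMap.id : ℂ →ₗ[ℂ] ℂ)
  have hΛ : ∀ n a, Λ (monomial n a) = (E (n - k)).eval ξ * a := by
    intro n a
    simp [Λ, lsum_apply, sum_monomial_index]
  have h1 : (laplace k E p).eval ξ = Λ (p.map (evalRingHom ξ)) := by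
    clear hp
    induction p using Polynomial.induction_on' with
    | add p q hp hq =>
      rw [laplace, sum_add_index _ _ _ (by simp) (fun a b c => add_mul b c _), eval_add,
        Polynomial.map_add, map_add]
      exact congrArg₂ _ hp hq
    | monomial n a =>
      rw [map_monomial, hΛ, laplace, sum_monomial_index _ _ (by simp)]
      simp [mul_comm]
  obtain ⟨g, hg⟩ := hp
  rw [h1, hg]
  clear h1 hg
  induction g using Polynomial.induction_on' with
  | add p q hp hq => rw [mul_add, map_add, hp, hq, add_zero]
  | monomial n a =>
    rw [sub_mul, one_mul, ← monomial_one_right_eq_X_pow, monomial_mul_monomial, map_sub, hΛ, hΛ,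
      one_mul, Nat.cast_add, ← hE (n - k), sub_eq_zero, add_sub_assoc, add_comm]

/-- The polynomial `q^(k (k + 1) / 2) z^k (z - 1) ∏_{i=1}^k (z + z⁻¹ - q^i - q^(-i))`. -/
def symbolPoly (R : Type*) [CommRing R] (k : ℕ) : R[X][X] :=
  ∏ i ∈ Finset.Icc (-k : ℤ) k, (C (X ^ (-i).toNat) * X - C (X ^ i.toNat))

theorem natDegree_symbolPoly_lt (R : Type*) [CommRing R] (k : ℕ) :
    (symbolPoly R k).natDegree < 2 * k + 2 := by
  refine lt_of_le_of_lt (natDegree_prod_le _ _) ?_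
  refine lt_of_le_of_lt (Finset.sum_le_card_nsmul _ _ 1 fun i _ => ?_) ?_
  · refine (natDegree_sub_le _ _).trans (max_le ?_ ?_)
    · exact (natDegree_C_mul_le _ _).trans natDegree_X_le
    · rw [natDegree_C]
      exact Nat.zero_le _
  · simp
    omega

theorem map_symbolPoly {R S : Type*} [CommRing R] [CommRing S] (f : R →+* S) (k : ℕ) :
    (symbolPoly R k).map (mapRingHom f) = symbolPoly S k := by
  simp [symbolPoly, Polynomial.map_prod]

/-- The left count is ⌊(2k+1)/d⌋ - ⌊k/d⌋, while an interval of 2k + 1 integers meets each class at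
least ⌊(2k+1)/d⌋ times; conclude with ⌊(2k+1)/d⌋ ≤ 2⌊k/d⌋ + 1. -/
theorem card_dvd_range_le {k d : ℕ} (hd : 0 < d) (t : ℤ) :
    2 * ((Finset.range (k + 1)).filter fun j => d ∣ k + 1 + j).card ≤
      ((Finset.Icc (-k : ℤ) k).filter fun i => i ≡ t [ZMOD d]).card + 1 := by
  have hd' : (0 : ℤ) < d := by exact_mod_cast hd
  have h1 : (((Finset.range (k + 1)).filter fun j => d ∣ k + 1 + j).card : ℤ) ≤
      (2 * k + 1 : ℤ) / d - (k : ℤ) / d := by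
    have h3 := Int.Ioc_filter_dvd_card (k : ℤ) (2 * k + 1) hd'
    have e1 := Rat.floor_intCast_div_natCast (2 * k + 1) d
    have e2 := Rat.floor_intCast_div_natCast k d
    push_cast at e1 e2 h3
    rw [e1, e2, max_eq_left (sub_nonneg.2 (Int.ediv_le_ediv hd' (by omega)))] at h3
    rw [← h3, Nat.cast_le]
    refine Finset.card_le_card_of_injOn (fun j => (k + 1 + j : ℤ)) (fun j hj => ?_) ?_
    · simp only [Finset.coe_filter, Finset.mem_range, Set.mem_ofPred_eq, Finset.mem_Ioc] at hj ⊢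
      exact ⟨by omega, by exact_mod_cast hj.2⟩
    · intro a _ c _ hac
      simpa using hac
  have h2 : (k - t) / d - (-k - 1 - t) / d ≤
      (((Finset.Icc (-k : ℤ) k).filter fun i => i ≡ t [ZMOD d]).card : ℤ) := by
    have h3 := Int.Ioc_filter_modEq_card (-k - 1 : ℤ) k hd' t
    have e1 := Rat.floor_intCast_div_natCast (k - t) d
    have e2 := Rat.floor_intCast_div_natCast (-k - 1 - t) d
    push_cast at e1 e2 h3
    have e3 : Finset.Ioc (-k - 1 : ℤ) k = Finset.Icc (-k : ℤ) k := by
      ext x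
      simp only [Finset.mem_Ioc, Finset.mem_Icc]
      omega
    rw [e1, e2, e3] at h3
    rw [h3]
    exact le_max_left _ _
  have h3 : (2 * k + 1 : ℤ) / d ≤ (k - t) / d - (-k - 1 - t) / d := by
    rw [le_sub_iff_add_le, Int.le_ediv_iff_mul_le hd', add_mul]
    have e1 := Int.ediv_mul_le (2 * k + 1 : ℤ) hd'.ne'
    have e2 := Int.ediv_mul_le (-k - 1 - t : ℤ) hd'.ne'
    linarith
  have h4 : (2 * k + 1 : ℤ) / d < 2 * ((k : ℤ) / d) + 2 := by
    rw [Int.ediv_lt_iff_lt_mul hd']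
    have e1 := Int.lt_ediv_add_one_mul_self (k : ℤ) hd'
    linarith
  omega

theorem rootMultiplicity_qPoch_le (k : ℕ) (ξ : ℂ) :
    (qPoch ((X : ℂ[X]) ^ (k + 1)) X (k + 1)).rootMultiplicity ξ ≤
      ((Finset.range (k + 1)).filter fun j => orderOf ξ ∣ k + 1 + j).card := by
  have h1 : ∀ n : ℕ, 0 < n → (1 - X ^ n : ℂ[X]) ≠ 0 ∧
      (1 - X ^ n : ℂ[X]).rootMultiplicity ξ ≤ if orderOf ξ ∣ n then 1 else 0 := by
    intro n hn
    have hne : (1 - X ^ n : ℂ[X]) ≠ 0 := by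
      intro e
      have := congrArg (eval 0) e
      simp [hn.ne'] at this
    refine ⟨hne, ?_⟩
    split_ifs with hd
    · have hξn := orderOf_dvd_iff_pow_eq_one.1 hd
      by_contra! hlt
      rw [one_lt_rootMultiplicity_iff_isRoot hne] at hlt
      have h2 := hlt.2
      simp only [IsRoot, derivative_sub, derivative_one, derivative_X_pow, zero_sub, eval_neg,
        eval_mul, eval_pow, eval_X, neg_eq_zero, mul_eq_zero, map_natCast, eval_natCast,
        Nat.cast_eq_zero, hn.ne', false_or] at h2
      have h3 := eq_zero_of_pow_eq_zero h2
      rw [h3, zero_pow hn.ne'] at hξn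
      exact zero_ne_one hξn
    · rw [Nat.le_zero, rootMultiplicity_eq_zero_iff]
      intro h
      simp only [IsRoot, eval_sub, eval_one, eval_pow, eval_X, sub_eq_zero] at h
      exact absurd (orderOf_dvd_iff_pow_eq_one.2 h.symm) hd
  have h2 : ∀ t : Finset ℕ, (∏ j ∈ t, (1 - (X : ℂ[X]) ^ (k + 1) * X ^ j)) ≠ 0 ∧
      (∏ j ∈ t, (1 - (X : ℂ[X]) ^ (k + 1) * X ^ j)).rootMultiplicity ξ ≤
        (t.filter fun j => orderOf ξ ∣ k + 1 + j).card := by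
    intro t
    induction t using Finset.induction_on with
    | empty => simp
    | insert a t ha ih =>
      obtain ⟨e1, e2⟩ := h1 (k + 1 + a) (by omega)
      rw [pow_add] at e1 e2
      rw [Finset.prod_insert ha]
      refine ⟨mul_ne_zero e1 ih.1, ?_⟩
      rw [rootMultiplicity_mul (mul_ne_zero e1 ih.1), Finset.filter_insert]
      split_ifs at e2 ⊢ with hd
      · rw [Finset.card_insert_of_notMem (by simp [ha])]
        omega
      · omega
  exact (h2 _).2

theorem symbolPoly_mem_pow {k : ℕ} {ξ : ℂ} (hξ : ξ ≠ 0) (t : ℕ) {d : ℕ} (hd : ξ ^ d = 1) :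
    symbolPoly ℂ k ∈ RingHom.ker (eval₂RingHom (evalRingHom ξ) (ξ ^ t)) ^
      ((Finset.Icc (-k : ℤ) k).filter fun i => i ≡ t [ZMOD d]).card := by
  refine prod_mem_pow_card _ _ _ _ fun i _ hi => ?_
  rw [RingHom.mem_ker]
  simp only [coe_eval₂RingHom, eval₂_sub, eval₂_mul, eval₂_C, eval₂_X, coe_evalRingHom, eval_pow,
    eval_X, sub_eq_zero]
  have h1 : ξ ^ t = ξ ^ i := by
    obtain ⟨c, hc⟩ := hi.dvd
    have : (t : ℤ) = i + d * c := by omega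
    rw [← zpow_natCast, this, zpow_add₀ hξ, zpow_mul, zpow_natCast, hd, one_zpow, mul_one]
  rw [h1, ← zpow_natCast, ← zpow_natCast, ← zpow_add₀ hξ]
  congr 1
  omega

theorem qPoch_dvd_laplace_complex {s : ℤ} {B k N n : ℕ} (hB : 0 < B) (hk : k ≤ n)
    (hN : ∀ d, 0 < d → d ≤ 2 * k + 1 → d ∣ N) {E : ℤ → ℂ[X]}
    (hE : ∀ ξ : ℂ, ξ ^ N = 1 → ∀ j, (E j).eval ξ = gaussVal (s * B) j ξ)
    (hode : ∀ j, (X ^ N - 1) ^ n ∣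
      (B : ℂ[X]) * (X * derivative (E j)) + ((s * j ^ 2 : ℤ) : ℂ[X]) * E j) :
    qPoch ((X : ℂ[X]) ^ (k + 1)) X (k + 1) ∣ laplace k E (symbolPoly ℂ k) := by
  set G := laplace k E (symbolPoly ℂ k) with hG
  have hD : qPoch ((X : ℂ[X]) ^ (k + 1)) X (k + 1) ≠ 0 := by
    intro e
    have := congrArg (eval 0) e
    simp [qPoch, eval_prod] at this
  by_cases hG0 : G = 0
  · rw [hG0]; exact dvd_zero _
  refine (IsAlgClosed.dvd_iff_roots_le_roots hD hG0).2 ?_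
  rw [Multiset.le_iff_count]
  intro ξ
  rw [count_roots, count_roots, le_rootMultiplicity_iff hG0]
  refine (pow_dvd_pow _ (rootMultiplicity_qPoch_le k ξ)).trans ?_
  set c := ((Finset.range (k + 1)).filter fun j => orderOf ξ ∣ k + 1 + j).card with hc
  rcases Nat.eq_zero_or_pos c with h0 | h0
  · simp [h0]
  obtain ⟨j, hj⟩ := Finset.card_pos.1 h0
  rw [Finset.mem_filter, Finset.mem_range] at hj
  have hd0 : 0 < orderOf ξ := Nat.pos_of_dvd_of_pos hj.2 (by omega)
  have hd1 : orderOf ξ ≤ 2 * k + 1 := (Nat.le_of_dvd (by omega) hj.2).trans (by omega)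
  have hξN : ξ ^ N = 1 := orderOf_dvd_iff_pow_eq_one.1 (hN _ hd0 hd1)
  have hξ0 : ξ ≠ 0 := by
    rintro rfl
    simp at hd0
  refine pow_dvd_of_iterate_euler hB hξ0 c G fun i hi => ?_
  have hck : c ≤ k + 1 := (Finset.card_filter_le _ _).trans (by simp)
  obtain ⟨g, hg⟩ := iterate_euler_laplace s B k E (X ^ N - 1) n hode (symbolPoly ℂ k) i
  rw [← hG] at hg
  have h1 : (laplace k E ((heatOp s B k)^[i] (symbolPoly ℂ k))).eval ξ = 0 := by
    refine eval_laplace_eq_zero (d := orderOf ξ) (fun j => ?_) ?_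
    · rw [hE ξ hξN, hE ξ hξN]
      apply gaussVal_congr
      rw [zpow_add₀ hξ0, zpow_natCast, pow_orderOf_eq_one, mul_one]
    · refine X_pow_sub_one_dvd_of_forall_root (IsPrimitiveRoot.orderOf ξ) hd0 fun ζ hζ => ?_
      have : NeZero (orderOf ξ) := ⟨hd0.ne'⟩
      obtain ⟨t, -, rfl⟩ := (IsPrimitiveRoot.orderOf ξ).eq_pow_of_pow_eq_one hζ
      have h2 := symbolPoly_mem_pow (k := k) hξ0 t (pow_orderOf_eq_one ξ)
      have h3 := card_dvd_range_le (k := k) hd0 t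
      -- Since i < c, the order 2c - 1 is at least 2i + 1, so one order of vanishing survives i heat
      -- operators.
      have h4 := heatOp_iterate_mem s B k _ i 1 (Ideal.pow_le_pow_right (by omega) h2)
      replace h4 := Ideal.pow_le_self one_ne_zero h4
      rw [RingHom.mem_ker, coe_eval₂RingHom] at h4
      rwa [eval_map]
  have h2 := congrArg (eval ξ) hg
  -- The error term vanishes at ξ because its exponent n + 1 - i is positive: i < c ≤ k + 1 ≤ n + 1.
  rw [eval_sub, h1, sub_zero, eval_mul, eval_pow, eval_sub, eval_pow, eval_X, eval_one, hξN,
    sub_self, zero_pow (by omega), zero_mul] at h2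
  exact h2

theorem map_laplace {R S : Type*} [CommRing R] [CommRing S] (f : R →+* S) (k : ℕ) (E : ℤ → R[X]) :
    (laplace k E (symbolPoly R k)).map f =
      laplace k (fun j => (E j).map f) (symbolPoly S k) := by
  rw [laplace_eq_sum_range k E _ (natDegree_symbolPoly_lt R k),
    laplace_eq_sum_range k _ _ (natDegree_symbolPoly_lt S k), Polynomial.map_sum,
    ← map_symbolPoly f]
  simp [coeff_map]

theorem associated_qPoch (R : Type*) [CommRing R] (k : ℕ) :
    Associated (qPoch ((X : R[X]) ^ (k + 1)) X (k + 1))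
      (∏ j ∈ Finset.range (k + 1), (X ^ (k + 1 + j) - 1 : R[X])) := by
  refine Associated.prod _ _ _ fun j _ => ⟨-1, ?_⟩
  rw [pow_add _ (k + 1) j, Units.val_neg, Units.val_one]
  ring

/-- Divisibility descends from ℂ to K because D is, up to sign, a product of the monic polynomials
X^i - 1. -/
theorem qPoch_dvd_laplace {K : Type*} [CommRing K] [Algebra K ℂ] [FaithfulSMul K ℂ] {s : ℤ}
    {B k N M : ℕ} (hB : 0 < B) (hk : k < M) (hN0 : 0 < N)
    (hN : ∀ d, 0 < d → d ≤ 2 * k + 1 → d ∣ N) {E : ℤ → K[X]}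
    (hE : ∀ j, IsGaussLift s B j N M (E j)) :
    qPoch ((X : K[X]) ^ (k + 1)) X (k + 1) ∣ laplace k E (symbolPoly K k) := by
  have hmonic : ((∏ j ∈ Finset.range (k + 1), (X ^ (k + 1 + j) - 1 : K[X]))).Monic :=
    monic_prod_of_monic _ _ fun j _ => monic_X_pow_sub_C 1 (by omega)
  rw [(associated_qPoch K k).dvd_iff_dvd_left]
  refine map_dvd_map_complex hmonic ?_
  rw [map_laplace]
  have h1 := qPoch_dvd_laplace_complex (s := s) (k := k) (N := N) (n := M - 1)
    (E := fun j => (E j).map (algebraMap K ℂ)) hB (by omega) hN ?_ ?_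
  · rw [(associated_qPoch ℂ k).dvd_iff_dvd_left] at h1
    simpa [Polynomial.map_prod] using h1
  · intro ξ hξ j
    rw [eval_map_algebraMap, (hE j).1 ξ hξ]
  · intro j
    have h2 := Polynomial.map_dvd (algebraMap K ℂ) ((hE j).dvd_derivative hB hN0)
    simpa [derivative_map] using h2

/-! ### Division in the completion -/

section Completion

variable {K : Type*} [CommRing K]

/-- The element of `lim K[q] / ((q; q)_n)` defined by a compatible family of polynomials. -/
def pochMk (f : ℕ → K[X]) (hf : ∀ m n, m ≤ n → qPoch (X : K[X]) X m ∣ f n - f m) :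
    pochCompletion (X : K[X]) X :=
  ⟨fun n => Ideal.Quotient.mk _ (f n), fun m n h => by
    rw [Ideal.Quotient.factor_mk, Ideal.Quotient.eq, Ideal.mem_span_singleton]
    exact hf m n h⟩

theorem pochMk_eq_iff {f g : ℕ → K[X]} {hf hg} :
    pochMk f hf = pochMk g hg ↔ ∀ n, qPoch (X : K[X]) X n ∣ f n - g n := by
  simp only [← Ideal.mem_span_singleton, ← Ideal.Quotient.eq]
  exact ⟨fun h n => congrFun (congrArg Subtype.val h) n, fun h => Subtype.ext (funext h)⟩

/-- The constant family of a polynomial. -/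
def pochOf (f : K[X]) : pochCompletion (X : K[X]) X := pochMk (fun _ => f) (by simp)

theorem pochOf_mul_pochMk (c : K[X]) (f : ℕ → K[X]) (hf) :
    pochOf c * pochMk f hf = pochMk (fun n => c * f n) fun m n h => by
      rw [← mul_sub]
      exact (hf m n h).mul_left c :=
  rfl

/-- Each (q; q)_n has the form 1 - q g_n, so g_n inverts q modulo it. -/
theorem isUnit_pochOf_X : IsUnit (pochOf (X : K[X])) := by
  have h : ∀ n, ∃ g : K[X], qPoch (X : K[X]) X n = 1 - X * g := by
    intro n
    induction n with
    | zero => exact ⟨0, by simp [qPoch]⟩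
    | succ n ih =>
      obtain ⟨g, hg⟩ := ih
      refine ⟨g + X ^ n - X * g * X ^ n, ?_⟩
      rw [qPoch, Finset.prod_range_succ, ← qPoch, hg]
      ring
  choose g hg using h
  have hreg : ∀ f : K[X], ∀ n, qPoch (X : K[X]) X n ∣ X * f → qPoch (X : K[X]) X n ∣ f := by
    intro f n hf
    have h1 : f = X * f * g n + qPoch X X n * f := by rw [hg]; ring
    rw [h1]
    exact dvd_add (hf.mul_right _) (dvd_mul_right _ _)
  refine IsUnit.of_mul_eq_one (pochMk g fun m n h => ?_) ?_
  · apply hreg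
    have h1 : X * (g n - g m) = qPoch X X m - qPoch X X n := by rw [hg, hg]; ring
    rw [h1]
    exact dvd_sub dvd_rfl (qPoch_dvd_of_le _ _ h)
  · rw [pochOf_mul_pochMk]
    change _ = pochMk (fun _ => 1) (by simp)
    rw [pochMk_eq_iff]
    intro n
    rw [← neg_sub, ← hg, dvd_neg]

/-- Each 1 - q^(k+1+j) divides 1 - q^((k+1+j)(n+1)); these exponents are distinct and exceed n, so
they leave the factors of (q; q)_n free. -/
theorem qPoch_mul_qPoch_dvd (k n : ℕ) :
    qPoch ((X : K[X]) ^ (k + 1)) X (k + 1) * qPoch (X : K[X]) X n ∣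
      qPoch (X : K[X]) X ((2 * k + 1) * (n + 1)) := by
  have hinj : Set.InjOn (fun j => (k + 1 + j) * (n + 1) - 1) (Finset.range (k + 1)) := by
    intro a _ c _ hac
    have h1 : 0 < (k + 1 + a) * (n + 1) := by positivity
    have h2 : 0 < (k + 1 + c) * (n + 1) := by positivity
    have h3 : (k + 1 + a) * (n + 1) = (k + 1 + c) * (n + 1) := by
      simp only at hac
      omega
    have h4 := Nat.eq_of_mul_eq_mul_right n.succ_pos h3
    omega
  have hge : ∀ j, n + 1 ≤ (k + 1 + j) * (n + 1) := fun j => Nat.le_mul_of_pos_left _ (by omega)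
  have hdisj : Disjoint ((Finset.range (k + 1)).image fun j => (k + 1 + j) * (n + 1) - 1)
      (Finset.range n) := by
    rw [Finset.disjoint_left]
    intro i hi hi'
    obtain ⟨j, -, rfl⟩ := Finset.mem_image.1 hi
    have := hge j
    rw [Finset.mem_range] at hi'
    omega
  have hsub : ((Finset.range (k + 1)).image fun j => (k + 1 + j) * (n + 1) - 1) ∪ Finset.range n ⊆
      Finset.range ((2 * k + 1) * (n + 1)) := by
    intro i hi
    rw [Finset.mem_range]
    rcases Finset.mem_union.1 hi with hi | hi
    · obtain ⟨j, hj, rfl⟩ := Finset.mem_image.1 hi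
      have h1 := hge j
      have h2 : (k + 1 + j) * (n + 1) ≤ (2 * k + 1) * (n + 1) :=
        Nat.mul_le_mul_right _ (by rw [Finset.mem_range] at hj; omega)
      omega
    · have h1 : n + 1 ≤ (2 * k + 1) * (n + 1) := Nat.le_mul_of_pos_left _ (by omega)
      rw [Finset.mem_range] at hi
      omega
  refine dvd_trans ?_ (Finset.prod_dvd_prod_of_subset _ _ _ hsub)
  rw [Finset.prod_union hdisj, Finset.prod_image hinj]
  refine mul_dvd_mul_right (Finset.prod_dvd_prod_of_dvd _ _ fun j _ => ?_) _
  rw [← pow_add, ← pow_succ', Nat.sub_add_cancel ((Nat.succ_pos n).trans_le (hge j)), pow_mul]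
  exact one_sub_dvd_one_sub_pow _ _

theorem pochOf_dvd_pochMk [IsDomain K] {k : ℕ} {f : ℕ → K[X]} {hf}
    (h : ∀ n, 2 * k + 1 ≤ n → qPoch ((X : K[X]) ^ (k + 1)) X (k + 1) ∣ f n) :
    pochOf (qPoch ((X : K[X]) ^ (k + 1)) X (k + 1)) ∣ pochMk f hf := by
  set D := qPoch ((X : K[X]) ^ (k + 1)) X (k + 1)
  have hD : D ≠ 0 := by
    intro e
    have := congrArg (eval 0) e
    simp [D, qPoch, eval_prod] at this
  have hle : ∀ n, 2 * k + 1 ≤ (2 * k + 1) * (n + 1) := fun n => Nat.le_mul_of_pos_right _ n.succ_pos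
  -- Dividing by D costs precision, so the quotient at level n is read off from level (2k + 1)(n +
  -- 1).
  choose g hg using fun n => h ((2 * k + 1) * (n + 1)) (hle n)
  refine ⟨pochMk g fun m n hmn => ?_, ?_⟩
  · rw [← mul_dvd_mul_iff_left hD, mul_sub, ← hg, ← hg]
    exact (qPoch_mul_qPoch_dvd k m).trans (hf _ _ (Nat.mul_le_mul_left _ (by omega)))
  · rw [pochOf_mul_pochMk, pochMk_eq_iff]
    intro n
    rw [← hg, ← dvd_neg, neg_sub]
    exact hf _ _ (by nlinarith)

theorem qPoch_dvd_level {n N : ℕ} (hN : n.factorial ∣ N) :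
    qPoch (X : K[X]) X n ∣ (X ^ N - 1) ^ (n + 1) := by
  refine dvd_trans ?_ (pow_dvd_pow _ n.le_succ)
  rw [qPoch, ← Finset.card_range n, ← Finset.prod_const, Finset.card_range]
  refine Finset.prod_dvd_prod_of_dvd _ _ fun j hj => ?_
  rw [← pow_succ', ← neg_sub, neg_dvd]
  exact pow_sub_one_dvd_of_dvd _
    ((Nat.dvd_factorial j.succ_pos (Finset.mem_range.1 hj)).trans hN)

end Completion

/-! ### The two factors as elements of S_b -/

/-- The evaluation of `S_b` at a root of unity of odd order. -/
def evS (b : ℤ) (ξ : ℂ) (hξ : Odd (orderOf ξ)) : CycS b →+* ℂ := (evR b ξ hξ).comp (cycSToR b)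

theorem evS_pochMk {b : ℤ} {ξ : ℂ} (hξ : Odd (orderOf ξ)) (f : ℕ → (ZInv b)[X]) (hf) :
    evS b ξ hξ (pochMk f hf) = aeval ξ (f (orderOf ξ + 1)) := by
  have h : 2 * ((orderOf ξ + 1) / 2) = orderOf ξ + 1 := by
    obtain ⟨m, hm⟩ := hξ
    omega
  rw [← h]
  rfl

theorem evS_pochOf {b : ℤ} {ξ : ℂ} (hξ : Odd (orderOf ξ)) (f : (ZInv b)[X]) :
    evS b ξ hξ (pochOf f) = aeval ξ f := evS_pochMk hξ _ _

instance (b : ℤ) : FaithfulSMul (ZInv b) ℂ := by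
  rw [faithfulSMul_iff_algebraMap_injective]
  intro x y h
  exact Subtype.ext ((algebraMap ℚ ℂ).injective h)

theorem isUnit_intCast_ZInv {b : ℤ} (hb : b ≠ 0) : IsUnit (b : ZInv b) := by
  refine IsUnit.of_mul_eq_one ⟨(b : ℚ)⁻¹, Algebra.subset_adjoin rfl⟩ ?_
  apply Subtype.ext
  push_cast
  exact mul_inv_cancel₀ (by exact_mod_cast hb)

theorem exists_laplace_element {b s : ℤ} {p l : ℕ} (hp : p.Prime) (hs : s * s = 1)
    (hb : b = s * (p ^ l : ℕ)) (k : ℕ) :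
    ∃ h e : CycS b, ∀ (ξ : ℂ) (hξ : Odd (orderOf ξ)),
      evS b ξ hξ e = gaussVal b 1 ξ ∧
      (qPoch (ξ ^ (k + 1)) ξ (k + 1)) * evS b ξ hξ h =
        ∑ m ∈ Finset.range (2 * k + 2),
          ((symbolPoly ℂ k).coeff m).eval ξ * gaussVal b (m - k) ξ := by
  have hB : 0 < p ^ l := pow_pos hp.pos l
  have hunit : IsUnit ((p ^ l : ℕ) : ZInv b) := by
    have hb0 : b ≠ 0 := by
      rw [hb]
      refine mul_ne_zero ?_ (by exact_mod_cast hB.ne')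
      rintro rfl
      simp at hs
    have h1 : (b : ZInv b) = s * ((p ^ l : ℕ) : ZInv b) := by
      exact_mod_cast congrArg (Int.cast : ℤ → ZInv b) hb
    have h2 := isUnit_intCast_ZInv hb0
    rw [h1] at h2
    exact isUnit_of_mul_isUnit_right h2
  have hN : ∀ n : ℕ, 0 < p ^ l * n.factorial := fun n => Nat.mul_pos hB n.factorial_pos
  choose E hE using fun (n : ℕ) (j : ℤ) => exists_isGaussLift (K := ZInv b) (M := n + 1) hs hp hunit
    (hN n) (dvd_mul_right _ _) n.succ_ne_zero j
  -- Restricted to the lower level, the lift at level n satisfies the conditions defining the one at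
  -- level m, so uniqueness makes them congruent.
  have hcompat : ∀ j m n, m ≤ n → qPoch (X : (ZInv b)[X]) X m ∣ E n j - E m j := by
    intro j m n hmn
    refine (qPoch_dvd_level (dvd_mul_left _ (p ^ l))).trans
      (IsGaussLift.dvd_sub hs hB hunit (hN m) ((hE n j).mono ?_ ?_) (hE m j))
    · exact mul_dvd_mul_left _ (Nat.factorial_dvd_factorial hmn)
    · omega
  have hdvd : pochOf (qPoch ((X : (ZInv b)[X]) ^ (k + 1)) X (k + 1)) ∣
      pochMk (fun n => laplace k (E n) (symbolPoly _ k)) (fun m n hmn => by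
        rw [laplace_eq_sum_range _ _ _ (natDegree_symbolPoly_lt _ k),
          laplace_eq_sum_range _ _ _ (natDegree_symbolPoly_lt _ k), ← Finset.sum_sub_distrib]
        refine Finset.dvd_sum fun i _ => ?_
        rw [← mul_sub]
        exact (hcompat _ m n hmn).mul_left _) := by
    refine pochOf_dvd_pochMk fun n hn => qPoch_dvd_laplace hB (by omega) (hN n) (fun d hd hd' => ?_)
      (hE n)
    exact (Nat.dvd_factorial hd (hd'.trans hn)).mul_left _
  obtain ⟨h, hh⟩ := hdvd
  refine ⟨h, pochMk (fun n => E n 1) (hcompat 1), fun ξ hξ => ?_⟩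
  have hval : ∀ j, aeval ξ (E (orderOf ξ + 1) j) = gaussVal b j ξ := by
    intro j
    rw [(hE _ j).1 ξ, hb]
    rw [← orderOf_dvd_iff_pow_eq_one]
    exact (Nat.dvd_factorial hξ.pos (Nat.le_succ _)).mul_left _
  refine ⟨by rw [evS_pochMk, hval], ?_⟩
  have h1 := congrArg (evS b ξ hξ) hh
  rw [evS_pochMk, map_mul, evS_pochOf] at h1
  have h2 : aeval ξ (qPoch ((X : (ZInv b)[X]) ^ (k + 1)) X (k + 1)) =
      qPoch (ξ ^ (k + 1)) ξ (k + 1) := by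
    simp [qPoch, map_prod]
  rw [← h2, ← h1, laplace_eq_sum_range _ _ _ (natDegree_symbolPoly_lt _ k), map_sum,
    ← map_symbolPoly (algebraMap (ZInv b) ℂ)]
  refine Finset.sum_congr rfl fun m _ => ?_
  rw [map_mul, hval, coeff_map, coe_mapRingHom, eval_map_algebraMap]

/-- Division by `q^(1/b) - 1` in `S_b`, up to the factor `1 - q`. -/
theorem exists_mul_sub_one_eq {b s : ℤ} {B : ℕ} (hs : s = 1 ∨ s = -1) (hB : 0 < B)
    (hb : b = s * B) (e : CycS b)
    (he : ∀ (ξ : ℂ) (hξ : Odd (orderOf ξ)), evS b ξ hξ e = gaussVal b 1 ξ) :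
    ∃ w : CycS b, ∀ (ξ : ℂ) (hξ : Odd (orderOf ξ)),
      evS b ξ hξ w * (gaussVal b 1 ξ - 1) = 1 - ξ := by
  obtain ⟨u, hu⟩ := (isUnit_pochOf_X (K := ZInv b)).exists_left_inv
  have hX : ∀ (ξ : ℂ) (hξ : Odd (orderOf ξ)), evS b ξ hξ (pochOf X) = ξ := fun ξ hξ => by
    rw [evS_pochOf, aeval_X]
  have hξ0 : ∀ ξ : ℂ, Odd (orderOf ξ) → ξ ≠ 0 := by
    rintro _ hξ rfl
    simp at hξ
  have hu' : ∀ (ξ : ℂ) (hξ : Odd (orderOf ξ)), evS b ξ hξ u = ξ⁻¹ := fun ξ hξ => by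
    have h1 := congrArg (evS b ξ hξ) hu
    rw [map_mul, hX, map_one] at h1
    exact eq_inv_of_mul_eq_one_left h1
  obtain ⟨y, v, hyv⟩ : ∃ y v : CycS b, ∀ (ξ : ℂ) (hξ : Odd (orderOf ξ)),
      evS b ξ hξ y = ξ ^ s ∧ evS b ξ hξ v * (ξ ^ (-s) - 1) = 1 - ξ := by
    rcases hs with rfl | rfl
    · refine ⟨pochOf X, pochOf X, fun ξ hξ => ?_⟩
      have := hξ0 ξ hξ
      rw [hX, zpow_neg, zpow_one]
      exact ⟨rfl, by field_simp⟩
    · refine ⟨u, -1, fun ξ hξ => ?_⟩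
      rw [hu', neg_neg, zpow_neg, zpow_one, map_neg, map_one]
      exact ⟨rfl, by ring⟩
  -- On values y e^B is 0 or 1. Where e is 0, the second term gives -(1 - ξ); elsewhere the
  -- geometric sum times e - 1 is e^B - 1 = ξ^(-s) - 1, which v turns into 1 - ξ.
  refine ⟨y * e ^ B * v * ∑ i ∈ Finset.range B, e ^ i - (1 - y * e ^ B) * (1 - pochOf X),
    fun ξ hξ => ?_⟩
  obtain ⟨hy, hv⟩ := hyv ξ hξ
  simp only [map_sub, map_mul, map_pow, map_sum, map_one, he, hy, hX]
  have hss : s * s = 1 := by rcases hs with rfl | rfl <;> rfl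
  have hg := gaussVal_eq_zero_or_pow hss B 1 ξ
  rw [← hb] at hg
  rcases hg with h | h
  · rw [h, zero_pow hB.ne']
    ring
  · have h1 : ξ ^ s * gaussVal b 1 ξ ^ B = 1 := by
      rw [h, ← zpow_add₀ (hξ0 ξ hξ)]
      simp
    have h2 := geom_sum_mul (gaussVal b 1 ξ) B
    rw [h, one_pow, mul_one] at h2
    rw [h1]
    linear_combination (evS b ξ hξ v) * h2 + hv

/-! ### Values of rational functions and of the sums over odd n -/

/-- The rational function `f` is regular at `ξ`, with value `v`. -/
def EvalsTo (ξ : ℂ) (f : RatFunc ℚ) (v : ℂ) : Prop :=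
  f.denom.eval₂ (algebraMap ℚ ℂ) ξ ≠ 0 ∧ f.eval (algebraMap ℚ ℂ) ξ = v

namespace EvalsTo

variable {ξ : ℂ} {f g : RatFunc ℚ} {v w : ℂ}

theorem add (hf : EvalsTo ξ f v) (hg : EvalsTo ξ g w) : EvalsTo ξ (f + g) (v + w) := by
  refine ⟨fun h => ?_, by rw [RatFunc.eval_add _ _ hf.1 hg.1, hf.2, hg.2]⟩
  have h1 := eval₂_eq_zero_of_dvd_of_eval₂_eq_zero _ _ (RatFunc.denom_add_dvd f g) h
  rw [eval₂_mul] at h1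
  exact (mul_ne_zero hf.1 hg.1) h1

theorem mul (hf : EvalsTo ξ f v) (hg : EvalsTo ξ g w) : EvalsTo ξ (f * g) (v * w) := by
  refine ⟨fun h => ?_, by rw [RatFunc.eval_mul _ _ hf.1 hg.1, hf.2, hg.2]⟩
  have h1 := eval₂_eq_zero_of_dvd_of_eval₂_eq_zero _ _ (RatFunc.denom_mul_dvd f g) h
  rw [eval₂_mul] at h1
  exact (mul_ne_zero hf.1 hg.1) h1

theorem const (ξ : ℂ) (c : ℚ) : EvalsTo ξ (RatFunc.C c) c := by
  refine ⟨?_, ?_⟩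
  · rw [RatFunc.denom_C, eval₂_one]
    exact one_ne_zero
  · rw [RatFunc.eval_C, eq_ratCast]

theorem one (ξ : ℂ) : EvalsTo ξ 1 1 := by
  simpa using const ξ 1

theorem var (ξ : ℂ) : EvalsTo ξ qv ξ := by
  refine ⟨by simp, by simp⟩

theorem sub (hf : EvalsTo ξ f v) (hg : EvalsTo ξ g w) : EvalsTo ξ (f - g) (v - w) := by
  have h := hf.add ((const ξ (-1)).mul hg)
  convert h using 1
  · rw [map_neg, map_one]
    ring
  · push_cast
    ring

theorem inv (hf : EvalsTo ξ f v) (hv : v ≠ 0) : EvalsTo ξ f⁻¹ v⁻¹ := by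
  have h1 : f.num.eval₂ (algebraMap ℚ ℂ) ξ ≠ 0 := by
    intro h
    apply hv
    rw [← hf.2, RatFunc.eval, h, zero_div]
  have h2 : (f⁻¹).denom.eval₂ (algebraMap ℚ ℂ) ξ ≠ 0 := by
    intro h
    have h3 : f⁻¹.denom ∣ f.num := by
      have := RatFunc.denom_div_dvd f.denom f.num
      rwa [← inv_div, RatFunc.num_div_denom] at this
    exact h1 (eval₂_eq_zero_of_dvd_of_eval₂_eq_zero _ _ h3 h)
  refine ⟨h2, ?_⟩
  have hf0 : f ≠ 0 := by
    rintro rfl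
    simp at h1
  have h3 := RatFunc.eval_mul _ _ hf.1 h2
  rw [mul_inv_cancel₀ hf0, RatFunc.eval_one, hf.2] at h3
  exact eq_inv_of_mul_eq_one_right h3.symm

theorem div (hf : EvalsTo ξ f v) (hg : EvalsTo ξ g w) (hw : w ≠ 0) : EvalsTo ξ (f / g) (v / w) := by
  rw [div_eq_mul_inv, div_eq_mul_inv]
  exact hf.mul (hg.inv hw)

theorem pow (hf : EvalsTo ξ f v) (n : ℕ) : EvalsTo ξ (f ^ n) (v ^ n) := by
  induction n with
  | zero => simpa using one ξ
  | succ n ih =>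
    rw [pow_succ, pow_succ]
    exact ih.mul hf

theorem zpow (hf : EvalsTo ξ f v) (hv : v ≠ 0) (n : ℤ) : EvalsTo ξ (f ^ n) (v ^ n) := by
  obtain ⟨n, rfl | rfl⟩ := n.eq_nat_or_neg
  · simpa using hf.pow n
  · simpa using (hf.pow n).inv (pow_ne_zero n hv)

theorem prod {ι : Type*} (t : Finset ι) {f : ι → RatFunc ℚ} {v : ι → ℂ}
    (h : ∀ i ∈ t, EvalsTo ξ (f i) (v i)) : EvalsTo ξ (∏ i ∈ t, f i) (∏ i ∈ t, v i) := by
  classical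
  induction t using Finset.induction_on with
  | empty => simpa using one ξ
  | insert a t ha ih =>
    rw [Finset.prod_insert ha, Finset.prod_insert ha]
    exact (h a (Finset.mem_insert_self _ _)).mul
      (ih fun i hi => h i (Finset.mem_insert_of_mem hi))

theorem sum {ι : Type*} (t : Finset ι) {f : ι → RatFunc ℚ} {v : ι → ℂ}
    (h : ∀ i ∈ t, EvalsTo ξ (f i) (v i)) : EvalsTo ξ (∑ i ∈ t, f i) (∑ i ∈ t, v i) := by
  classical
  induction t using Finset.induction_on with
  | empty => simpa using const ξ 0
  | insert a t ha ih =>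
    rw [Finset.sum_insert ha, Finset.sum_insert ha]
    exact (h a (Finset.mem_insert_self _ _)).add
      (ih fun i hi => h i (Finset.mem_insert_of_mem hi))

end EvalsTo

theorem xiSum_eq_sum_range {ξ : ℂ} {f : ℕ → RatFunc ℚ} {v : ℕ → ℂ}
    (h : ∀ m, EvalsTo ξ (f (2 * m + 1)) (v m)) :
    xiSum ξ f = ∑ m ∈ Finset.range (orderOf ξ), v m := by
  refine Finset.sum_nbij' (fun n => n / 2) (fun m => 2 * m + 1) ?_ ?_ ?_ ?_ ?_
  · intro n hn
    simp only [Finset.mem_filter, Finset.mem_range] at hn ⊢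
    omega
  · intro m hm
    simp only [Finset.mem_filter, Finset.mem_range] at hm ⊢
    exact ⟨by omega, ⟨m, rfl⟩⟩
  · intro n hn
    obtain ⟨m, rfl⟩ := (Finset.mem_filter.1 hn).2
    omega
  · intro m _
    omega
  · intro n hn
    obtain ⟨m, rfl⟩ := (Finset.mem_filter.1 hn).2
    rw [show (2 * m + 1) / 2 = m by omega]
    exact (h m).2

theorem evalsTo_framingFactor {ξ : ℂ} (hξ : ξ ≠ 0) (b : ℤ) (m : ℕ) :
    EvalsTo ξ (framingFactor b (2 * m + 1)) (ξ ^ (b * (m * (m + 1)) : ℤ)) := by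
  have h : (((2 * m + 1 : ℕ) : ℤ) ^ 2 - 1) / 4 = m * (m + 1) := by
    refine Int.ediv_eq_of_eq_mul_left (by norm_num) ?_
    push_cast
    ring
  rw [framingFactor, h]
  exact (EvalsTo.var ξ).zpow hξ _

theorem qv_ne_one : qv ≠ 1 := by
  intro h
  have := congrArg (RatFunc.eval (RingHom.id ℚ) 0) h
  simp at this

theorem evalsTo_quantumInt {ξ : ℂ} (hξ : ξ ≠ 0) (m : ℕ) :
    EvalsTo ξ (quantumInt (2 * m + 1)) (ξ ^ (-(m : ℤ)) * ∑ i ∈ Finset.range (2 * m + 1), ξ ^ i) := by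
  have h : (((2 * m + 1 : ℕ) : ℤ) - 1) / 2 = m := by omega
  rw [quantumInt, h, ← geom_sum_eq qv_ne_one]
  exact ((EvalsTo.var ξ).zpow hξ _).mul (EvalsTo.sum _ fun i _ => (EvalsTo.var ξ).pow i)

theorem evalsTo_cycA {ξ : ℂ} (hξ : ξ ≠ 0) (hξ1 : ξ ≠ 1) {k : ℕ}
    (hk : qPoch (ξ ^ (k + 1)) ξ (k + 1) ≠ 0) (n : ℕ) :
    EvalsTo ξ (cycA n k)
      ((∏ i ∈ Finset.range (k + 1), (ξ ^ n + ξ ^ (-(n : ℤ)) - ξ ^ i - ξ ^ (-(i : ℤ)))) /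
        ((1 - ξ) * qPoch (ξ ^ (k + 1)) ξ (k + 1))) := by
  have hq := EvalsTo.var ξ
  refine EvalsTo.div (EvalsTo.prod _ fun i _ => ?_) (EvalsTo.mul ((EvalsTo.one ξ).sub hq)
    (EvalsTo.prod _ fun i _ => ?_)) (mul_ne_zero (sub_ne_zero.2 hξ1.symm) hk)
  · exact (((hq.pow n).add (hq.zpow hξ _)).sub (hq.pow i)).sub (hq.zpow hξ _)
  · exact (EvalsTo.one ξ).sub ((hq.pow _).mul (hq.pow _))

/-- This identity in ℚ(q) removes the pole of the displayed fraction at q = 1, so k = 0 is covered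
at ξ = 1 too. -/
theorem cycA_zero_eq (m : ℕ) : cycA (2 * m + 1) 0 = qv⁻¹ * quantumInt (2 * m + 1) ^ 2 := by
  have h : (((2 * m + 1 : ℕ) : ℤ) - 1) / 2 = m := by omega
  have h0 : qv ≠ 0 := RatFunc.X_ne_zero
  have h1 : qv - 1 ≠ 0 := sub_ne_zero.2 qv_ne_one
  have h2 : 1 - qv ≠ 0 := sub_ne_zero.2 qv_ne_one.symm
  rw [cycA, quantumInt, h, zpow_neg, zpow_neg, zpow_natCast, zpow_natCast]
  simp only [qPoch, zero_add, Finset.prod_range_one, pow_zero, pow_one, mul_one, Nat.cast_zero,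
    neg_zero, zpow_zero]
  generalize qv = q at *
  have h3 : (1 - q) * (1 - q) = (q - 1) ^ 2 := by ring
  rw [h3]
  field_simp
  ring

/-! ### The sums of A(n, k) as Laplace transforms -/

/-- Evaluation of the symbol at `z = x`, `q = ξ`. -/
theorem eval_symbolPoly {ξ x : ℂ} (hξ : ξ ≠ 0) (hx : x ≠ 0) (k : ℕ) :
    (symbolPoly ℂ k).eval₂ (evalRingHom ξ) x =
      ξ ^ (∑ i ∈ Finset.range k, (i + 1)) * x ^ k *
        ((x - 1) * ∏ i ∈ Finset.range k,
          (x + x⁻¹ - ξ ^ (i + 1) - ξ ^ (-((i + 1 : ℕ) : ℤ)))) := by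
  rw [symbolPoly, eval₂_finsetProd]
  simp only [eval₂_sub, eval₂_mul, eval₂_C, eval₂_X, coe_evalRingHom, eval_pow, eval_X]
  induction k with
  | zero => simp
  | succ k ih =>
    have h1 : Finset.Icc (-(k + 1 : ℕ) : ℤ) (k + 1 : ℕ) =
        insert (-(k + 1 : ℕ) : ℤ) (insert ((k + 1 : ℕ) : ℤ) (Finset.Icc (-k : ℤ) k)) := by
      ext i
      simp only [Finset.mem_Icc, Finset.mem_insert]
      omega
    have h2 : (-(-(k + 1 : ℕ) : ℤ)).toNat = k + 1 := by omega
    have h3 : (-(k + 1 : ℕ) : ℤ).toNat = 0 := by omega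
    have h4 : ((k + 1 : ℕ) : ℤ).toNat = k + 1 := by omega
    rw [h1, Finset.prod_insert, Finset.prod_insert, ih, h2, h3, h4, Finset.prod_range_succ,
      Finset.sum_range_succ, zpow_neg, zpow_natCast, pow_zero, one_mul, pow_add ξ, pow_succ x]
    · have := pow_ne_zero (k + 1) hξ
      generalize ξ ^ (k + 1) = a at *
      field_simp
      ring
    · simp
    · simp only [Finset.mem_insert, Finset.mem_Icc]
      omega

theorem sum_symbolPoly {ξ : ℂ} (hr : Odd (orderOf ξ)) (b : ℤ) (k : ℕ) :
    ξ ^ (∑ i ∈ Finset.range k, (i + 1)) *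
      ∑ m ∈ Finset.range (orderOf ξ), ξ ^ (b * (m * (m + 1)) : ℤ) *
        ∏ i ∈ Finset.range (k + 1),
          (ξ ^ (2 * m + 1) + ξ ^ (-((2 * m + 1 : ℕ) : ℤ)) - ξ ^ i - ξ ^ (-(i : ℤ))) =
    2 * (∑ m ∈ Finset.range (orderOf ξ), ξ ^ (b * (m * (m + 1)) : ℤ)) *
      ∑ m ∈ Finset.range (2 * k + 2),
        ((symbolPoly ℂ k).coeff m).eval ξ * gaussVal b (m - k) ξ := by
  have hξ : ξ ≠ 0 := by
    rintro rfl
    simp at hr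
  have hξr := pow_orderOf_eq_one ξ
  let V : ℂ → ℂ := fun x => (x - 1) * ∏ i ∈ Finset.range k,
    (x + x⁻¹ - ξ ^ (i + 1) - ξ ^ (-((i + 1 : ℕ) : ℤ)))
  have hV : ∀ m : ℕ, ∏ i ∈ Finset.range (k + 1),
      (ξ ^ (2 * m + 1) + ξ ^ (-((2 * m + 1 : ℕ) : ℤ)) - ξ ^ i - ξ ^ (-(i : ℤ))) =
      V (ξ ^ (2 * m + 1)) + V (ξ ^ (2 * m + 1))⁻¹ := by
    intro m
    rw [Finset.prod_range_succ', zpow_neg, zpow_natCast]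
    simp only [V, inv_inv, add_comm (ξ ^ (2 * m + 1))⁻¹, pow_zero, Nat.cast_zero, neg_zero,
      zpow_zero]
    ring
  -- The reflection m ↦ r - 1 - m preserves the quadratic exponent modulo r and inverts ξ^(2m + 1).
  have hrefl : ∑ m ∈ Finset.range (orderOf ξ), ξ ^ (b * (m * (m + 1)) : ℤ) * V (ξ ^ (2 * m + 1))⁻¹ =
      ∑ m ∈ Finset.range (orderOf ξ), ξ ^ (b * (m * (m + 1)) : ℤ) * V (ξ ^ (2 * m + 1)) := by
    rw [← Finset.sum_range_reflect]
    refine Finset.sum_congr rfl fun m hm => ?_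
    rw [Finset.mem_range] at hm
    obtain ⟨c, hc⟩ : ∃ c, orderOf ξ = m + 1 + c := ⟨_, (Nat.add_sub_cancel' hm).symm⟩
    rw [show orderOf ξ - 1 - m = c by omega]
    have h1 : (ξ ^ (2 * c + 1))⁻¹ = ξ ^ (2 * m + 1) := by
      rw [inv_eq_iff_eq_inv, ← one_div, eq_div_iff (pow_ne_zero _ hξ), ← pow_add,
        show 2 * c + 1 + (2 * m + 1) = orderOf ξ * 2 by omega, pow_mul, hξr, one_pow]
    have h2 : ξ ^ (b * (c * (c + 1)) : ℤ) = ξ ^ (b * (m * (m + 1)) : ℤ) := by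
      have h3 : (b * (c * (c + 1)) : ℤ) = b * (m * (m + 1)) + (orderOf ξ : ℕ) * (b * (c - m)) := by
        rw [hc]
        push_cast
        ring
      rw [h3, zpow_add₀ hξ, zpow_mul ξ (orderOf ξ : ℕ), zpow_natCast, hξr, one_zpow, mul_one]
    rw [h1, h2]
  have hsum : ∑ m ∈ Finset.range (orderOf ξ), ξ ^ (b * (m * (m + 1)) : ℤ) *
      ∏ i ∈ Finset.range (k + 1),
        (ξ ^ (2 * m + 1) + ξ ^ (-((2 * m + 1 : ℕ) : ℤ)) - ξ ^ i - ξ ^ (-(i : ℤ))) =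
      2 * ∑ m ∈ Finset.range (orderOf ξ), ξ ^ (b * (m * (m + 1)) : ℤ) * V (ξ ^ (2 * m + 1)) := by
    rw [two_mul]
    nth_rewrite 2 [← hrefl]
    rw [← Finset.sum_add_distrib]
    exact Finset.sum_congr rfl fun m _ => by rw [hV, mul_add]
  rw [hsum, mul_left_comm, mul_assoc 2]
  congr 1
  rw [Finset.mul_sum, Finset.mul_sum]
  have hterm : ∀ m : ℕ, ξ ^ (∑ i ∈ Finset.range k, (i + 1)) *
      (ξ ^ (b * (m * (m + 1)) : ℤ) * V (ξ ^ (2 * m + 1))) =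
      ∑ i ∈ Finset.range (2 * k + 2), ((symbolPoly ℂ k).coeff i).eval ξ *
        ξ ^ (b * (m * (m + 1)) + (i - k) * (2 * m + 1) : ℤ) := by
    intro m
    have hx : ξ ^ (2 * m + 1) ≠ 0 := pow_ne_zero _ hξ
    have h1 := eval_symbolPoly hξ hx k
    rw [eval₂_eq_sum_range' _ (natDegree_symbolPoly_lt ℂ k)] at h1
    have h2 : ∀ i : ℕ, ξ ^ (b * (m * (m + 1)) + (i - k) * (2 * m + 1) : ℤ) *
        (ξ ^ (2 * m + 1)) ^ k = ξ ^ (b * (m * (m + 1)) : ℤ) * (ξ ^ (2 * m + 1)) ^ i := by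
      intro i
      rw [← pow_mul, ← pow_mul, ← zpow_natCast, ← zpow_natCast, ← zpow_add₀ hξ, ← zpow_add₀ hξ]
      congr 1
      push_cast
      ring
    refine mul_right_cancel₀ (pow_ne_zero k hx) ?_
    rw [Finset.sum_mul]
    simp_rw [mul_assoc (eval ξ _), h2]
    simp_rw [mul_left_comm (eval ξ _)]
    rw [← Finset.mul_sum]
    simp only [coe_evalRingHom] at h1
    rw [h1]
    ring
  simp_rw [hterm]
  rw [Finset.sum_comm]
  refine Finset.sum_congr rfl fun i _ => ?_
  rw [← Finset.mul_sum]
  have := gaussSum_range hr b (i - k)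
  rw [this]
  ring

theorem FUnknot_eq_sum {ξ : ℂ} (hξ : ξ ≠ 0) (b : ℤ) :
    FUnknot b ξ = ∑ m ∈ Finset.range (orderOf ξ), ξ ^ (b * (m * (m + 1)) : ℤ) *
      (ξ ^ (-(m : ℤ)) * ∑ i ∈ Finset.range (2 * m + 1), ξ ^ i) ^ 2 := by
  refine xiSum_eq_sum_range fun m => ?_
  rw [jonesUnknot, mul_assoc, ← pow_two]
  exact (evalsTo_framingFactor hξ b m).mul ((evalsTo_quantumInt hξ m).pow 2)

/-- The case k = 0 of `sum_symbolPoly`, whose symbol is z - 1; the factor ξ comes from [n]² = q A(n,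
0). -/
theorem FUnknot_mul {ξ : ℂ} (hr : Odd (orderOf ξ)) (hξ1 : ξ ≠ 1) (b : ℤ) :
    FUnknot b ξ * (1 - ξ) ^ 2 =
      2 * ξ * (∑ m ∈ Finset.range (orderOf ξ), ξ ^ (b * (m * (m + 1)) : ℤ)) *
        (gaussVal b 1 ξ - 1) := by
  have hξ : ξ ≠ 0 := by
    rintro rfl
    simp at hr
  have h1 := sum_symbolPoly hr b 0
  have h0 : gaussVal b 0 ξ = 1 := by
    rw [gaussVal_of_zpow_eq (h := 0) (by simp)]
    simp
  have h2 : ∑ m ∈ Finset.range (2 * 0 + 2),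
      ((symbolPoly ℂ 0).coeff m).eval ξ * gaussVal b (m - (0 : ℕ)) ξ = gaussVal b 1 ξ - 1 := by
    simp [Finset.sum_range_succ, symbolPoly, coeff_X, coeff_one, h0]
    ring
  rw [h2, Finset.range_zero, Finset.sum_empty, pow_zero, one_mul] at h1
  have h3 : 2 * ξ * (∑ m ∈ Finset.range (orderOf ξ), ξ ^ (b * (m * (m + 1)) : ℤ)) *
      (gaussVal b 1 ξ - 1) = ξ * (2 * (∑ m ∈ Finset.range (orderOf ξ),
        ξ ^ (b * (m * (m + 1)) : ℤ)) * (gaussVal b 1 ξ - 1)) := by ring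
  rw [FUnknot_eq_sum hξ, h3, ← h1, Finset.sum_mul, Finset.mul_sum]
  refine Finset.sum_congr rfl fun m _ => ?_
  have h4 := geom_sum_mul ξ (2 * m + 1)
  have h5 : (ξ ^ (-(m : ℤ)) * ∑ i ∈ Finset.range (2 * m + 1), ξ ^ i) ^ 2 * (1 - ξ) ^ 2 =
      (ξ ^ (-(m : ℤ))) ^ 2 * (ξ ^ (2 * m + 1) - 1) ^ 2 := by
    rw [← h4]
    ring
  rw [mul_assoc, h5, mul_left_comm ξ]
  congr 1
  rw [zero_add, Finset.prod_range_one, zpow_neg, zpow_neg, zpow_natCast, zpow_natCast,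
    pow_zero, Nat.cast_zero, neg_zero, zpow_zero, pow_succ ξ (2 * m), mul_comm 2 m, pow_mul]
  have h6 := pow_ne_zero m hξ
  generalize ξ ^ m = a at *
  field_simp
  ring

theorem FUnknot_ne_zero {ξ : ℂ} (hr : Odd (orderOf ξ)) (b : ℤ) : FUnknot b ξ ≠ 0 := by
  by_cases hξ1 : ξ = 1
  · subst hξ1
    rw [FUnknot_eq_sum one_ne_zero, orderOf_one]
    simp
  have hξ : ξ ≠ 0 := by
    rintro rfl
    simp at hr
  intro h
  have h1 := FUnknot_mul hr hξ1 b
  rw [h, zero_mul] at h1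
  exact mul_ne_zero (mul_ne_zero (mul_ne_zero two_ne_zero hξ) (gaussSum_range_ne_zero hr b))
    (sub_ne_zero.2 (gaussVal_one_ne_one hξ1)) h1.symm

theorem xiSum_cycA_zero {ξ : ℂ} (hξ : ξ ≠ 0) (b : ℤ) :
    xiSum ξ (fun n => framingFactor b n * cycA n 0) = ξ⁻¹ * FUnknot b ξ := by
  rw [FUnknot_eq_sum hξ, Finset.mul_sum]
  refine xiSum_eq_sum_range fun m => ?_
  rw [cycA_zero_eq, mul_left_comm]
  exact ((EvalsTo.var ξ).inv hξ).mul
    ((evalsTo_framingFactor hξ b m).mul ((evalsTo_quantumInt hξ m).pow 2))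

theorem qPoch_ne_zero_of_lt_orderOf {ξ : ℂ} {k : ℕ} (hk : 2 * k + 1 < orderOf ξ) :
    qPoch (ξ ^ (k + 1)) ξ (k + 1) ≠ 0 := by
  refine Finset.prod_ne_zero_iff.2 fun j hj => ?_
  rw [Finset.mem_range] at hj
  rw [← pow_add, sub_ne_zero]
  intro h
  have := orderOf_le_of_pow_eq_one (by omega) h.symm
  omega

theorem xiSum_cycA {ξ : ℂ} (hr : Odd (orderOf ξ)) (b : ℤ) {k : ℕ} (hk : 2 * k + 1 < orderOf ξ) :
    xiSum ξ (fun n => framingFactor b n * cycA n k) *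
        (ξ ^ (∑ i ∈ Finset.range k, (i + 1)) * ((1 - ξ) * qPoch (ξ ^ (k + 1)) ξ (k + 1))) =
      2 * (∑ m ∈ Finset.range (orderOf ξ), ξ ^ (b * (m * (m + 1)) : ℤ)) *
        ∑ m ∈ Finset.range (2 * k + 2),
          ((symbolPoly ℂ k).coeff m).eval ξ * gaussVal b (m - k) ξ := by
  have hξ : ξ ≠ 0 := by
    rintro rfl
    simp at hr
  have hξ1 : ξ ≠ 1 := by
    rintro rfl
    rw [orderOf_one] at hk
    omega
  have hD := qPoch_ne_zero_of_lt_orderOf hk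
  have hD' := mul_ne_zero (sub_ne_zero.2 hξ1.symm) hD
  rw [← sum_symbolPoly hr, mul_left_comm, xiSum_eq_sum_range fun m =>
    (evalsTo_framingFactor hξ b m).mul (evalsTo_cycA hξ hξ1 hD (2 * m + 1)), Finset.sum_mul]
  congr 1
  refine Finset.sum_congr rfl fun m _ => ?_
  rw [mul_assoc, div_mul_cancel₀ _ hD']

/-! ### Assembling the element Q -/

theorem exists_eq_sign_mul_prime_pow {b : ℤ} (hb : b = 1 ∨ b = -1 ∨
    ∃ p l : ℕ, p.Prime ∧ 0 < l ∧ (b = (p : ℤ) ^ l ∨ b = -(p : ℤ) ^ l)) :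
    ∃ (s : ℤ) (p l : ℕ), p.Prime ∧ (s = 1 ∨ s = -1) ∧ b = s * (p ^ l : ℕ) := by
  rcases hb with rfl | rfl | ⟨p, l, hp, -, rfl | rfl⟩
  -- The values b = ±1 are treated as ±2^0.
  · exact ⟨1, 2, 0, Nat.prime_two, Or.inl rfl, by simp⟩
  · exact ⟨-1, 2, 0, Nat.prime_two, Or.inr rfl, by simp⟩
  · exact ⟨1, p, l, hp, Or.inl rfl, by simp⟩
  · exact ⟨-1, p, l, hp, Or.inr rfl, by simp⟩

theorem mainTheorem3 (b : ℤ)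
    (hb : b = 1 ∨ b = -1 ∨
      ∃ p l : ℕ, p.Prime ∧ 0 < l ∧ (b = (p : ℤ) ^ l ∨ b = -(p : ℤ) ^ l))
    (k : ℕ) :
    ∃ Q : CycR b,
      (∀ (ξ : ℂ) (hξ : Odd (orderOf ξ)),
        FUnknot b ξ ≠ 0 ∧
          ((k = 0 ∨ 2 * k + 1 < orderOf ξ) →
            xiSum ξ (fun n => framingFactor b n * cycA n k) / FUnknot b ξ = evR b ξ hξ Q)) ∧
      (Odd b → ∃ Q' : CycS b, cycSToR b Q' = Q) := by
  suffices h : ∃ Q : CycS b, ∀ (ξ : ℂ) (hξ : Odd (orderOf ξ)), (k = 0 ∨ 2 * k + 1 < orderOf ξ) →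
      xiSum ξ (fun n => framingFactor b n * cycA n k) / FUnknot b ξ = evS b ξ hξ Q by
    obtain ⟨Q, hQ⟩ := h
    exact ⟨cycSToR b Q, fun ξ hξ => ⟨FUnknot_ne_zero hξ b, hQ ξ hξ⟩, fun _ => ⟨Q, rfl⟩⟩
  obtain ⟨u, hu⟩ := (isUnit_pochOf_X (K := ZInv b)).exists_left_inv
  have hξ0 : ∀ ξ : ℂ, Odd (orderOf ξ) → ξ ≠ 0 := by
    rintro _ hξ rfl
    simp at hξ
  have hu' : ∀ (ξ : ℂ) (hξ : Odd (orderOf ξ)), evS b ξ hξ u = ξ⁻¹ := fun ξ hξ => by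
    have h1 := congrArg (evS b ξ hξ) hu
    rw [map_mul, evS_pochOf, aeval_X, map_one] at h1
    exact eq_inv_of_mul_eq_one_left h1
  rcases Nat.eq_zero_or_pos k with rfl | hk
  · refine ⟨u, fun ξ hξ _ => ?_⟩
    rw [hu', xiSum_cycA_zero (hξ0 ξ hξ), mul_div_cancel_right₀ _ (FUnknot_ne_zero hξ b)]
  obtain ⟨s, p, l, hp, hs, hb'⟩ := exists_eq_sign_mul_prime_pow hb
  have hss : s * s = 1 := by rcases hs with rfl | rfl <;> rfl
  obtain ⟨h, e, he⟩ := exists_laplace_element hp hss hb' k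
  obtain ⟨w, hw⟩ := exists_mul_sub_one_eq hs (pow_pos hp.pos l) hb' e fun ξ hξ => (he ξ hξ).1
  -- The exponent k(k+1)/2 of q⁻¹ undoes the normalisation of the symbol; the extra 1 cancels the
  -- factor ξ in `FUnknot_mul`.
  refine ⟨h * w * u ^ ((∑ i ∈ Finset.range k, (i + 1)) + 1), fun ξ hξ hkr => ?_⟩
  replace hkr := hkr.resolve_left hk.ne'
  have hξ1 : ξ ≠ 1 := by
    rintro rfl
    rw [orderOf_one] at hkr
    omega
  have hξ' := hξ0 ξ hξ
  have h1 := xiSum_cycA hξ b hkr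
  rw [← (he ξ hξ).2] at h1
  have h2 := FUnknot_mul hξ hξ1 b
  have h3 := hw ξ hξ
  have hD := qPoch_ne_zero_of_lt_orderOf hkr
  have h1ξ : 1 - ξ ≠ 0 := sub_ne_zero.2 hξ1.symm
  have hκ := pow_ne_zero (∑ i ∈ Finset.range k, (i + 1)) hξ'
  rw [map_mul, map_mul, map_pow, hu', inv_pow, div_eq_iff (FUnknot_ne_zero hξ b), pow_succ]
  generalize ξ ^ (∑ i ∈ Finset.range k, (i + 1)) = y at *
  generalize qPoch (ξ ^ (k + 1)) ξ (k + 1) = D at *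
  generalize xiSum ξ (fun n => framingFactor b n * cycA n k) = S at *
  generalize ∑ m ∈ Finset.range (orderOf ξ), ξ ^ (b * (m * (m + 1)) : ℤ) = Γ at *
  generalize FUnknot b ξ = F at *
  generalize gaussVal b 1 ξ = g at *
  generalize evS b ξ hξ h = H at *
  generalize evS b ξ hξ w = ω at *
  field_simp
  refine mul_left_cancel₀ (mul_ne_zero (pow_ne_zero 2 h1ξ) hD) ?_
  linear_combination (1 - ξ) * ξ * h1 - D * H * ω * h2 - 2 * ξ * Γ * D * H * h3

end
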